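/- Conventions. A Hadamard space is a complete geodesic metric space $(\mathcal H,d)$ such that $d(x,\gamma(t))^2\le(1-t)\,d(x,\gamma(0))^2+t\,d(x,\gamma(1))^2-t(1-t)\,d(\gamma(0),\gamma(1))^2$ for every $x\in\mathcal H$, every geodesic $\gamma:[0,1]\to\mathcal H$ and every $t\in[0,1]$; geodesics have constant speed and may be constant. A function $f:\mathcal H\to(-\infty,\infty]$ is convex if $f\circ\gamma$ is convex for every geodesic $\gamma:[0,1]\to\mathcal H$, lsc if it is lower semicontinuous, and proper if $\operatorname{dom}f=\{x: f(x)<\infty\}$ is nonempty. For proper convex lsc $f$, $x\in\mathcal H$, $\lambda>0$ and $t>0$ put $$J_\lambda x=\operatorname*{arg\,min}_{y\in\mathcal H}\Big[f(y)+\tfrac1{2\lambda}d(x,y)^2\Big],\qquad S_t x=\lim_{k\to\infty}\big(J_{t/k}\big)^{(k)}x .$$ Let $(\mathcal H,d)$ and $(\mathcal H^n,d^n)$, $n\in\mathbb N$, be Hadamard spaces with a given asymptotic relation, i.e. a topology on the disjoint union $\mathcal X=\big(\bigsqcup_n\mathcal H^n\big)\sqcup\mathcal H$ such that, writing $x_n\to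 x$ (for $x_n\in\mathcal H^n$, $x\in\mathcal H$) for convergence in $\mathcal X$: - (A1) all $\mathcal H^n$ and $\mathcal H$ are closed in $\mathcal X$, and $\mathcal X$ induces on each of them its metric topology; - (A2) for every $x\in\mathcal H$ there are $x_n\in\mathcal H^n$ with $x_n\to x$; - (A3) if $x_n\to x$ and $y_n\to y$, then $d^n(x_n,y_n)\to d(x,y)$; - (A4) if $x_n\to x$, $y_n\in\mathcal H^n$ and $d^n(x_n,y_n)\to0$, then $y_n\to x$. A sequence $x_n\in\mathcal H^n$ converges weakly to $x\in\mathcal H$ if it is bounded (i.e. $\sup_n d^n(x_n,y_n)<\infty$ for some $y_n\in\mathcal H^n$ with $y_n\to y\in\mathcal H$) and, for all geodesics $\gamma^n:[0,1]\to\mathcal H^n$ and $\gamma:[0,1]\to\mathcal H$ with $\gamma(0)=x$, $\gamma^n(0)\to\gamma(0)$ and $\gamma^n(1)\to\gamma(1)$, the nearest points $P_{\gamma^n}(x_n)$ of $\gamma^n([0,1])$ to $x_n$ satisfy $P_{\gamma^n}(x_n)\to x$. Functions $f^n:\mathcal H^n\to(-\infty,\infty]$ converge to $f:\mathcal H\to(-\infty,\infty]$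 in the sense of Mosco if for every $x\in\mathcal H$: $f(x)\le\liminf_n f^n(x_n)$ whenever $x_n\in\mathcal H^n$ converges weakly to $x$, and there are $y_n\in\mathcal H^n$ with $y_n\to x$ and $f^n(y_n)\to f(x)$. Theorem. Let $f:\mathcal H\to(-\infty,\infty]$ and $f^n:\mathcal H^n\to(-\infty,\infty]$, $n\in\mathbb N$, be proper convex lsc functions, with resolvents $J_\lambda$, $J^n_\lambda$ and semigroups $S_t$, $S^n_t$ defined by the formulas above. Then the following hold. (0) For each of these functions, for every point of its space and all $\lambda,t>0$, the minimum in the definition of the resolvent is attained at exactly one point and the limit in the definition of the semigroup exists. (1) Suppose that $J^n_\lambda x_n\to J_\lambda x$ for every $x\in\overline{\operatorname{dom}}\,f$, all $x_n\in\mathcal H^n$ with $x_n\to x$, and every $\lambda>0$. Then $S^n_t x_n\to S_t x$ for every $x\in\overline{\operatorname{dom}}\,f$, all $x_n\in\mathcal H^n$ with $x_n\to x$, and every $t>0$. (2) If $f^n\to f$ in the sense of Mosco, then $S^n_t x_n\to S_t x$ for every $x\in\overline{\operatorname{dom}}\,f$, all $x_n\in\mathcal H^n$ with $x_n\to x$,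 and every $t>0$. -/

import Mathlib

open Set Filter Topology

noncomputable section

namespace HadamardFlow

universe u v

section SingleSpace

variable {X : Type u} [MetricSpace X]

/-- A (constant speed) geodesic `[0,1] → X`. Only the values on `[0,1]` matter. -/
def IsGeodesic (γ : ℝ → X) : Prop :=
  ∀ s ∈ Icc (0 : ℝ) 1, ∀ t ∈ Icc (0 : ℝ) 1, dist (γ s) (γ t) = |s - t| * dist (γ 0) (γ 1)

/-- Hadamard spaces: complete geodesic metric spaces of nonpositive curvature (CAT(0)). -/
class HadamardSpace (X : Type u) [MetricSpace X] : Prop extends CompleteSpace X where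
  exists_geodesic : ∀ x y : X, ∃ γ : ℝ → X, IsGeodesic γ ∧ γ 0 = x ∧ γ 1 = y
  cat_zero : ∀ (x : X) (γ : ℝ → X), IsGeodesic γ → ∀ t ∈ Icc (0 : ℝ) 1,
    dist x (γ t) ^ 2 ≤
      (1 - t) * dist x (γ 0) ^ 2 + t * dist x (γ 1) ^ 2 - t * (1 - t) * dist (γ 0) (γ 1) ^ 2

/-- The effective domain `dom f = {x | f x < ∞}`. -/
def effDomain (f : X → EReal) : Set X := {x | f x < ⊤}

/-- Convexity along all geodesics. -/
def GeodesicallyConvex (f : X → EReal) : Prop :=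
  ∀ γ : ℝ → X, IsGeodesic γ → ∀ t ∈ Icc (0 : ℝ) 1,
    f (γ t) ≤ ((1 - t : ℝ) : EReal) * f (γ 0) + (t : EReal) * f (γ 1)

/-- Proper convex lower semicontinuous functions with values in `(-∞, ∞]`. -/
structure IsProperConvexLsc (f : X → EReal) : Prop where
  ne_bot : ∀ x, f x ≠ ⊥
  proper : (effDomain f).Nonempty
  convex : GeodesicallyConvex f
  lsc : LowerSemicontinuous f

/-- `y` minimizes `z ↦ f z + d(x,z)² / (2λ)`. -/
def IsProxPoint (f : X → EReal) (lam : ℝ) (x y : X) : Prop :=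
  ∀ z : X, f y + ((dist x y ^ 2 / (2 * lam) : ℝ) : EReal) ≤
    f z + ((dist x z ^ 2 / (2 * lam) : ℝ) : EReal)

open Classical in
/-- The resolvent `J_λ x = argmin_y [f y + d(x,y)² / (2λ)]` for `λ > 0`, with `J_0 x = x`. -/
def resolventMap (f : X → EReal) (lam : ℝ) (x : X) : X :=
  if h : 0 < lam ∧ ∃ y, IsProxPoint f lam x y then h.2.choose else x

/-- `y = lim_k (J_{t/k})^(k) x`. -/
def IsSemigroupLimit (f : X → EReal) (t : ℝ) (x y : X) : Prop :=
  Tendsto (fun k : ℕ => (resolventMap f (t / k))^[k] x) atTop (𝓝 y)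

open Classical in
/-- The gradient flow semigroup `S_t x = lim_k (J_{t/k})^(k) x`. -/
def semigroupMap (f : X → EReal) (t : ℝ) (x : X) : X :=
  if h : ∃ y, IsSemigroupLimit f t x y then h.choose else x

open Classical in
/-- The metric projection of `x` onto `C`: the point of `C` nearest to `x`. -/
def metricProj (C : Set X) (x : X) : X :=
  if h : ∃ p ∈ C, ∀ q ∈ C, dist x p ≤ dist x q then h.choose else x

/-- The minimum defining the resolvent is attained at exactly one point, and the limit defining
the semigroup exists. -/
def ResolventAndSemigroupWellDefined (f : X → EReal) : Prop :=
  (∀ (lam : ℝ) (x : X), 0 < lam → ∃! y, IsProxPoint f lam x y) ∧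
    ∀ (t : ℝ) (x : X), 0 < t → ∃ y, IsSemigroupLimit f t x y

end SingleSpace

/-- The disjoint union of the spaces `Xs n`, `n ∈ ℕ`, and `X`, as a bare set. -/
inductive TotalSpace (Xs : ℕ → Type v) (X : Type u) : Type (max u v)
  | approx (n : ℕ) (x : Xs n) : TotalSpace Xs X
  | limit (x : X) : TotalSpace Xs X

section VaryingSpaces

variable {Xs : ℕ → Type v} {X : Type u} [∀ n, MetricSpace (Xs n)] [MetricSpace X]
  [TopologicalSpace (TotalSpace Xs X)]

/-- A sequence `xs n ∈ Xs n` converges to `x ∈ X` in the topology of the disjoint union. -/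
def ConvergesTo (xs : ∀ n, Xs n) (x : X) : Prop :=
  Tendsto (fun n => (TotalSpace.approx n (xs n) : TotalSpace Xs X)) atTop
    (𝓝 (TotalSpace.limit x))

/-- The given topology on the disjoint union is an asymptotic relation between `Xs` and `X`. -/
structure IsAsymptoticRelation (Xs : ℕ → Type v) (X : Type u) [∀ n, MetricSpace (Xs n)]
    [MetricSpace X] [TopologicalSpace (TotalSpace Xs X)] : Prop where
  isClosedEmbedding_approx : ∀ n,
    IsClosedEmbedding (TotalSpace.approx n : Xs n → TotalSpace Xs X)
  isClosedEmbedding_limit : IsClosedEmbedding (TotalSpace.limit : X → TotalSpace Xs X)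
  exists_converging : ∀ x : X, ∃ xs : ∀ n, Xs n, ConvergesTo xs x
  tendsto_dist : ∀ (xs ys : ∀ n, Xs n) (x y : X), ConvergesTo xs x → ConvergesTo ys y →
    Tendsto (fun n => dist (xs n) (ys n)) atTop (𝓝 (dist x y))
  converges_of_dist : ∀ (xs ys : ∀ n, Xs n) (x : X), ConvergesTo xs x →
    Tendsto (fun n => dist (xs n) (ys n)) atTop (𝓝 0) → ConvergesTo ys x

/-- A sequence `xs n ∈ Xs n` is bounded if it stays at bounded distance from some sequence
`ys n ∈ Xs n` converging to a point of `X`. -/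
def IsBoundedSeq (X : Type u) [MetricSpace X] [TopologicalSpace (TotalSpace Xs X)]
    (xs : ∀ n, Xs n) : Prop :=
  ∃ (ys : ∀ n, Xs n) (y : X) (R : ℝ), ConvergesTo ys y ∧ ∀ n, dist (xs n) (ys n) ≤ R

/-- Weak convergence of `xs n ∈ Xs n` to `x ∈ X`. -/
structure WeaklyConvergesTo (xs : ∀ n, Xs n) (x : X) : Prop where
  bounded : IsBoundedSeq X xs
  proj : ∀ (γs : ∀ n, ℝ → Xs n) (γ : ℝ → X), (∀ n, IsGeodesic (γs n)) → IsGeodesic γ → γ 0 = x →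
    ConvergesTo (fun n => γs n 0) (γ 0) → ConvergesTo (fun n => γs n 1) (γ 1) →
      ConvergesTo (fun n => metricProj (γs n '' Icc 0 1) (xs n)) x

/-- Mosco convergence of functions `fs n` on `Xs n` to a function `f` on `X`. -/
structure MoscoConvergesTo (fs : ∀ n, Xs n → EReal) (f : X → EReal) : Prop where
  le_liminf : ∀ (x : X) (xs : ∀ n, Xs n), WeaklyConvergesTo xs x →
    f x ≤ liminf (fun n => fs n (xs n)) atTop
  exists_recovery : ∀ x : X, ∃ ys : ∀ n, Xs n, ConvergesTo ys x ∧
    Tendsto (fun n => fs n (ys n)) atTop (𝓝 (f x))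

end VaryingSpaces

end HadamardFlow

end

open HadamardFlow

namespace HadamardFlow

section SingleSpace

universe u

variable {X : Type u} [MetricSpace X]

/-! ### Geodesics -/

/-! Everything in a single space rests on the variational inequality for `J_λ x`: the proximal
objective is strongly convex along geodesics by CAT(0), so it exceeds its minimum by at least `d² /
(2λ)`. Adding two such inequalities gives nonexpansiveness of `J_λ` and the Cauchy property of `J_λ
x` as `λ → 0`. Combined with the resolvent identity and CAT(0), nonexpansiveness yields the
Crandall–Liggett estimate, and from it existence of `S_t x` together with the bound `2 d + (d / ν) t
/ √k`, `d = d(x, J_ν x)`, on the distance from `(J_{t/k})^(k) x` to `S_t x` when `t / k ≤ ν`.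

This bound involves the function only through `d(x, J_ν x)`, a quantity that is continuous under
convergence of resolvents and small for suitable `ν` when `x` lies in the closure of the domain.
Hence one fixed `k` approximates all semigroups with late index at once, and finitely many resolvent
steps pass to the limit. This is (1).

For (2) it remains to see that Mosco convergence forces resolvents to converge. Bounded sequences
have weakly convergent subsequences, obtained from asymptotic centers; a weak limit of resolvents
competes with `J_λ x`, and the surplus term of the variational inequality turns weak into strong
convergence. -/

lemma IsGeodesic.dist_zero {γ : ℝ → X} (hγ : IsGeodesic γ) {t : ℝ} (ht : t ∈ Icc (0 : ℝ) 1) :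
    dist (γ 0) (γ t) = t * dist (γ 0) (γ 1) := by
  rw [hγ 0 (by simp) t ht, zero_sub, abs_neg, abs_of_nonneg ht.1]

lemma IsGeodesic.dist_one {γ : ℝ → X} (hγ : IsGeodesic γ) {t : ℝ} (ht : t ∈ Icc (0 : ℝ) 1) :
    dist (γ t) (γ 1) = (1 - t) * dist (γ 0) (γ 1) := by
  rw [hγ t ht 1 (by simp), abs_sub_comm, abs_of_nonneg (by linarith [ht.2])]

lemma IsGeodesic.continuousOn {γ : ℝ → X} (hγ : IsGeodesic γ) : ContinuousOn γ (Icc 0 1) := by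
  have h : LipschitzOnWith (Real.toNNReal (dist (γ 0) (γ 1))) γ (Icc 0 1) :=
    LipschitzOnWith.of_dist_le_mul fun s hs t ht => by
      rw [hγ s hs t ht, Real.coe_toNNReal _ dist_nonneg, Real.dist_eq, mul_comm]
  exact h.continuousOn

/-- The reparametrized restriction of a geodesic is a geodesic. -/
lemma IsGeodesic.restrict {γ : ℝ → X} (hγ : IsGeodesic γ) {a b : ℝ} (ha : a ∈ Icc (0 : ℝ) 1)
    (hb : b ∈ Icc (0 : ℝ) 1) : IsGeodesic fun t => γ (a + t * (b - a)) := by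
  have mem : ∀ t ∈ Icc (0 : ℝ) 1, a + t * (b - a) ∈ Icc (0 : ℝ) 1 := fun t ht => by
    rw [mem_Icc] at *
    constructor <;> nlinarith [mul_nonneg ht.1 hb.1, mul_nonneg (sub_nonneg.2 ht.2) ha.1,
      mul_nonneg ht.1 (sub_nonneg.2 hb.2), mul_nonneg (sub_nonneg.2 ht.2) (sub_nonneg.2 ha.2)]
  intro s hs t ht
  simp only [zero_mul, add_zero, one_mul, add_sub_cancel]
  rw [hγ _ (mem s hs) _ (mem t ht), hγ a ha b hb, ← mul_assoc,
    show a + s * (b - a) - (a + t * (b - a)) = (s - t) * (b - a) by ring, abs_mul,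
    abs_sub_comm a b]

/-- A quadratic growth estimate at a minimum along a geodesic. -/
lemma add_le_of_forall_le_convex {a b κ : ℝ} (hκ : 0 ≤ κ)
    (h : ∀ t ∈ Ioc (0 : ℝ) 1, a ≤ (1 - t) * a + t * b - t * (1 - t) * κ) : a + κ ≤ b := by
  have key : ∀ t ∈ Ioc (0 : ℝ) 1, a + κ - t * κ ≤ b := fun t ht => by
    have h1 := h t ht
    have h2 : 0 ≤ t * (b - (a + κ - t * κ)) := by nlinarith
    linarith [nonneg_of_mul_nonneg_right h2 ht.1]
  refine le_of_forall_pos_le_add fun ε hε => ?_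
  -- This parameter lies in `(0, 1]` and makes the loss `t * κ` at most `ε`.
  have hpos : 0 < ε / (ε + κ + 1) := by positivity
  have hle : ε / (ε + κ + 1) ≤ 1 := by rw [div_le_one (by positivity)]; linarith
  have h1 := key _ ⟨hpos, hle⟩
  have h2 : ε / (ε + κ + 1) * κ ≤ ε := by
    rw [div_mul_eq_mul_div, div_le_iff₀ (by positivity)]
    nlinarith
  linarith

/-! ### Projections onto geodesics -/

lemma metricProj_geodesic_spec {γ : ℝ → X} (hγ : IsGeodesic γ) (x : X) :
    metricProj (γ '' Icc 0 1) x ∈ γ '' Icc 0 1 ∧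
      ∀ q ∈ γ '' Icc 0 1, dist x (metricProj (γ '' Icc 0 1) x) ≤ dist x q := by
  have h : ∃ p ∈ γ '' Icc 0 1, ∀ q ∈ γ '' Icc 0 1, dist x p ≤ dist x q :=
    (isCompact_Icc.image_of_continuousOn hγ.continuousOn).exists_isMinOn (f := fun q => dist x q)
      ⟨γ 0, mem_image_of_mem _ (by simp)⟩ (by fun_prop)
  rw [metricProj, dif_pos h]
  exact h.choose_spec

/-! ### Convex functions as real functions on their domain -/

namespace IsProperConvexLsc

variable {f : X → EReal}

lemma coe_toReal (hf : IsProperConvexLsc f) {x : X} (hx : x ∈ effDomain f) :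
    ((f x).toReal : EReal) = f x :=
  EReal.coe_toReal (ne_of_lt hx) (hf.ne_bot x)

lemma mem_effDomain_and_le (hf : IsProperConvexLsc f) {x : X} {b : ℝ} (h : f x ≤ b) :
    x ∈ effDomain f ∧ (f x).toReal ≤ b := by
  have hx : x ∈ effDomain f := lt_of_le_of_lt h (EReal.coe_lt_top b)
  exact ⟨hx, by rwa [← hf.coe_toReal hx, EReal.coe_le_coe_iff] at h⟩

lemma convex_toReal (hf : IsProperConvexLsc f) {γ : ℝ → X} (hγ : IsGeodesic γ)
    (h0 : γ 0 ∈ effDomain f) (h1 : γ 1 ∈ effDomain f) {t : ℝ} (ht : t ∈ Icc (0 : ℝ) 1) :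
    γ t ∈ effDomain f ∧
      (f (γ t)).toReal ≤ (1 - t) * (f (γ 0)).toReal + t * (f (γ 1)).toReal := by
  refine hf.mem_effDomain_and_le ?_
  have := hf.convex γ hγ t ht
  rw [← hf.coe_toReal h0, ← hf.coe_toReal h1] at this
  exact_mod_cast this

/-- Lower semicontinuity against a moving real bound; it puts the limit of a minimizing sequence in
the domain and bounds its value. -/
lemma le_coe_of_tendsto (hf : IsProperConvexLsc f) {z : ℕ → X} {z₀ : X} {b : ℕ → ℝ} {b₀ : ℝ}
    (hz : Tendsto z atTop (𝓝 z₀)) (hb : Tendsto b atTop (𝓝 b₀)) (h : ∀ n, f (z n) ≤ b n) :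
    f z₀ ≤ b₀ := by
  refine le_of_forall_lt fun c hc => ?_
  obtain ⟨c', hc1, hc2⟩ := exists_between hc
  have h1 : ∀ᶠ n in atTop, c' < f (z n) := hz.eventually (hf.lsc z₀ c' hc2)
  have h2 : Tendsto (fun n => (b n : EReal)) atTop (𝓝 b₀) :=
    (continuous_coe_real_ereal.tendsto b₀).comp hb
  exact hc1.trans_le (ge_of_tendsto h2 (h1.mono fun n hn => hn.le.trans (h n)))

lemma isProxPoint_iff (hf : IsProperConvexLsc f) {lam : ℝ} {x y : X} :
    IsProxPoint f lam x y ↔ y ∈ effDomain f ∧ ∀ z ∈ effDomain f,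
      (f y).toReal + dist x y ^ 2 / (2 * lam) ≤ (f z).toReal + dist x z ^ 2 / (2 * lam) := by
  constructor
  · intro h
    have hy : y ∈ effDomain f := by
      obtain ⟨o, ho⟩ := hf.proper
      have h1 := h o
      rw [← hf.coe_toReal ho, ← EReal.coe_add] at h1
      by_contra hy
      have hy' : f y = ⊤ := by simpa [effDomain] using hy
      rw [hy', EReal.top_add_coe] at h1
      exact absurd h1 (not_le.2 (EReal.coe_lt_top _))
    refine ⟨hy, fun z hz => ?_⟩
    have h1 := h z
    rw [← hf.coe_toReal hy, ← hf.coe_toReal hz] at h1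
    exact_mod_cast h1
  · rintro ⟨hy, h⟩ z
    by_cases hz : z ∈ effDomain f
    · rw [← hf.coe_toReal hy, ← hf.coe_toReal hz]
      exact_mod_cast h z hz
    · have hz' : f z = ⊤ := by simpa [effDomain] using hz
      rw [hz', EReal.top_add_coe]
      exact le_top

end IsProperConvexLsc

/-! ### Quadratic inequalities in Hadamard spaces. -/

variable [HadamardSpace X]

/-- The sum of the squared diagonals of a quadrilateral in a Hadamard space is at most the sum of
its squared sides. -/
lemma sq_dist_diagonals_le (x u v y : X) :
    dist x v ^ 2 + dist u y ^ 2 ≤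
      dist x u ^ 2 + dist u v ^ 2 + dist v y ^ 2 + dist x y ^ 2 := by
  obtain ⟨γ, hγ, rfl, rfl⟩ := HadamardSpace.exists_geodesic x v
  -- Both remaining vertices are compared with the midpoint of the diagonal `xv`; the other diagonal
  -- is controlled through that midpoint by `(a + b)² ≤ 2a² + 2b²`.
  have h1 := HadamardSpace.cat_zero u γ hγ (1 / 2) (by norm_num)
  have h2 := HadamardSpace.cat_zero y γ hγ (1 / 2) (by norm_num)
  have h3 := dist_triangle_right u y (γ (1 / 2))
  rw [dist_comm u (γ 0)] at h1
  rw [dist_comm y (γ 0), dist_comm y (γ 1)] at h2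
  have h4 : dist u y ^ 2 ≤ 2 * dist u (γ (1 / 2)) ^ 2 + 2 * dist y (γ (1 / 2)) ^ 2 := by
    have := pow_le_pow_left₀ dist_nonneg h3 2
    nlinarith [sq_nonneg (dist u (γ (1 / 2)) - dist y (γ (1 / 2)))]
  nlinarith

/-- The Pythagorean inequality for projections onto geodesics. -/
lemma sq_dist_metricProj_add_le {γ : ℝ → X} (hγ : IsGeodesic γ) (x : X) {q : X}
    (hq : q ∈ γ '' Icc 0 1) :
    dist x (metricProj (γ '' Icc 0 1) x) ^ 2 + dist (metricProj (γ '' Icc 0 1) x) q ^ 2 ≤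
      dist x q ^ 2 := by
  obtain ⟨⟨a, ha, hp⟩, hmin⟩ := metricProj_geodesic_spec hγ x
  obtain ⟨b, hb, rfl⟩ := hq
  rw [← hp] at hmin ⊢
  -- The segment from the projection to `q` stays inside the geodesic, so minimality applies at each
  -- of its points.
  refine add_le_of_forall_le_convex (sq_nonneg _) fun t ht => ?_
  have hsub := HadamardSpace.cat_zero x _ (hγ.restrict ha hb) t ⟨ht.1.le, ht.2⟩
  simp only [zero_mul, add_zero, one_mul, add_sub_cancel] at hsub
  refine le_trans (pow_le_pow_left₀ dist_nonneg (hmin _ (mem_image_of_mem _ ?_)) 2) hsub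
  rw [mem_Icc] at *
  constructor <;> nlinarith [mul_nonneg ht.1.le hb.1, mul_nonneg (sub_nonneg.2 ht.2) ha.1,
      mul_nonneg ht.1.le (sub_nonneg.2 hb.2), mul_nonneg (sub_nonneg.2 ht.2) (sub_nonneg.2 ha.2)]

namespace IsProperConvexLsc

variable {f : X → EReal}

/-! ### Existence of the minimum in the definition of the resolvent -/

/-- A convex function that is bounded below near a point has a linear lower bound. -/
lemma linear_lower_bound (hf : IsProperConvexLsc f) {o z : X} {C c r : ℝ} (hr : 0 < r)
    (ho : f o ≤ C) (hc : c ≤ C) (hball : ∀ u, dist o u < r → (c : EReal) ≤ f u)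
    (hz : z ∈ effDomain f) :
    c - (C - c) * dist o z / (r / 2) ≤ (f z).toReal := by
  obtain ⟨hoD, hoC⟩ := hf.mem_effDomain_and_le ho
  have hle : ∀ u ∈ effDomain f, dist o u < r → c ≤ (f u).toReal := fun u hu hd => by
    have := hball u hd
    rw [← hf.coe_toReal hu] at this
    exact_mod_cast this
  by_cases hd : dist o z < r
  · have : 0 ≤ (C - c) * dist o z / (r / 2) :=
      div_nonneg (mul_nonneg (by linarith) dist_nonneg) (by linarith)
    linarith [hle z hz hd]
  · push Not at hd
    obtain ⟨γ, hγ, rfl, rfl⟩ := HadamardSpace.exists_geodesic o z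
    set d := dist (γ 0) (γ 1)
    have hdpos : 0 < d := hr.trans_le hd
    -- The point at distance `r / 2` from `o` lies in the ball; its lower bound is extrapolated to
    -- `z` by convexity.
    set t := r / 2 / d with ht
    have htd : t * d = r / 2 := by rw [ht]; field_simp
    have ht0 : 0 < t := by positivity
    have ht1 : t ≤ 1 := by rw [ht, div_le_one hdpos]; linarith
    obtain ⟨h1, h2⟩ := hf.convex_toReal hγ hoD hz ⟨ht0.le, ht1⟩
    have h3 := hle _ h1 (by rw [hγ.dist_zero ⟨ht0.le, ht1⟩]; linarith [htd])
    have hfin : t * (c - (C - c) * d / (r / 2)) = t * c - (C - c) := by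
      rw [ht]; field_simp
    have : t * (c - (C - c) * d / (r / 2)) ≤ t * (f (γ 1)).toReal := by
      rw [hfin]
      nlinarith [mul_le_mul_of_nonneg_left hoC (sub_nonneg.2 ht1)]
    exact le_of_mul_le_mul_left this ht0

/-- The objective function of the resolvent is bounded below. -/
lemma bddBelow_prox (hf : IsProperConvexLsc f) {lam : ℝ} (hlam : 0 < lam) (x : X) :
    BddBelow ((fun z => (f z).toReal + dist x z ^ 2 / (2 * lam)) '' effDomain f) := by
  obtain ⟨o, ho⟩ := hf.proper
  set C := (f o).toReal with hC
  have hCo : (C : EReal) = f o := hf.coe_toReal ho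
  have hnear : ∀ᶠ u in 𝓝 o, ((C - 1 : ℝ) : EReal) < f u :=
    hf.lsc o _ (by change _ < f o; rw [← hCo]; exact_mod_cast (by linarith : C - 1 < C))
  obtain ⟨r, hr, hball⟩ := Metric.eventually_nhds_iff.1 hnear
  set B := 1 / (r / 2) with hB
  have hB0 : 0 < B := by positivity
  -- Completing the square: `(d(x,z) - Bλ)² ≥ 0` lets the quadratic term absorb the linear decay of
  -- `f`.
  refine ⟨C - 1 - B * dist o x - B ^ 2 * lam / 2, ?_⟩
  rintro _ ⟨z, hz, rfl⟩
  have h1 := hf.linear_lower_bound hr hCo.ge (by linarith : C - 1 ≤ C)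
    (fun u hu => (hball (by rwa [dist_comm])).le) hz
  have h2 : (C - (C - 1)) * dist o z / (r / 2) = B * dist o z := by rw [hB]; ring
  rw [h2] at h1
  have h3 := mul_le_mul_of_nonneg_left (dist_triangle o x z) hB0.le
  have h4 : 0 ≤ (dist x z - B * lam) ^ 2 / (2 * lam) := by positivity
  have h5 : (dist x z - B * lam) ^ 2 / (2 * lam) =
      dist x z ^ 2 / (2 * lam) - B * dist x z + B ^ 2 * lam / 2 := by
    field_simp; ring
  simp only
  linarith

/-- Strong convexity of the objective function of the resolvent. -/
lemma prox_strongly_convex (hf : IsProperConvexLsc f) {lam : ℝ} (hlam : 0 < lam) (x : X)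
    {γ : ℝ → X} (hγ : IsGeodesic γ) (h0 : γ 0 ∈ effDomain f) (h1 : γ 1 ∈ effDomain f) {t : ℝ}
    (ht : t ∈ Icc (0 : ℝ) 1) :
    (f (γ t)).toReal + dist x (γ t) ^ 2 / (2 * lam) ≤
      (1 - t) * ((f (γ 0)).toReal + dist x (γ 0) ^ 2 / (2 * lam)) +
        t * ((f (γ 1)).toReal + dist x (γ 1) ^ 2 / (2 * lam)) -
        t * (1 - t) * (dist (γ 0) (γ 1) ^ 2 / (2 * lam)) := by
  have h2 := (hf.convex_toReal hγ h0 h1 ht).2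
  have h3 := div_le_div_of_nonneg_right (HadamardSpace.cat_zero x γ hγ t ht)
    (by positivity : (0 : ℝ) ≤ 2 * lam)
  have h4 : ((1 - t) * dist x (γ 0) ^ 2 + t * dist x (γ 1) ^ 2 -
      t * (1 - t) * dist (γ 0) (γ 1) ^ 2) / (2 * lam) = (1 - t) * (dist x (γ 0) ^ 2 / (2 * lam)) +
      t * (dist x (γ 1) ^ 2 / (2 * lam)) - t * (1 - t) * (dist (γ 0) (γ 1) ^ 2 / (2 * lam)) := by
    ring
  linarith

/-- By strong convexity at midpoints, minimizing sequences are Cauchy; completeness and lower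
semicontinuity then give a minimizer without any compactness. -/
lemma exists_isProxPoint (hf : IsProperConvexLsc f) {lam : ℝ} (hlam : 0 < lam) (x : X) :
    ∃ y, IsProxPoint f lam x y := by
  set g : X → ℝ := fun z => (f z).toReal + dist x z ^ 2 / (2 * lam) with hg
  have hbdd : BddBelow (g '' effDomain f) := hf.bddBelow_prox hlam x
  set m := sInf (g '' effDomain f)
  have hm : ∀ z ∈ effDomain f, m ≤ g z := fun z hz => csInf_le hbdd (mem_image_of_mem g hz)
  have hex : ∀ k : ℕ, ∃ z ∈ effDomain f, g z < m + 1 / ((k : ℝ) + 1) := fun k => by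
    obtain ⟨_, ⟨z, hz, rfl⟩, hlt⟩ := exists_lt_of_csInf_lt (hf.proper.image g)
      (lt_add_of_pos_right m (by positivity : (0 : ℝ) < 1 / ((k : ℝ) + 1)))
    exact ⟨z, hz, hlt⟩
  choose z hzD hzlt using hex
  -- If both values are below `m + 1/(N+1)`, the midpoint value, which is at least `m`, gains `d² /
  -- (8λ)`; hence the constant `8λ`.
  have hdist : ∀ N k l : ℕ, N ≤ k → N ≤ l →
      dist (z k) (z l) ≤ √(8 * lam * (1 / ((N : ℝ) + 1))) := by
    intro N k l hk hl
    obtain ⟨γ, hγ, h0, h1⟩ := HadamardSpace.exists_geodesic (z k) (z l)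
    have hh : (1 / 2 : ℝ) ∈ Icc (0 : ℝ) 1 := by norm_num
    have h0D : γ 0 ∈ effDomain f := h0 ▸ hzD k
    have h1D : γ 1 ∈ effDomain f := h1 ▸ hzD l
    have hc := hf.prox_strongly_convex hlam x hγ h0D h1D hh
    have hmm := hm _ (hf.convex_toReal hγ h0D h1D hh).1
    have hk' : g (z k) < m + 1 / ((N : ℝ) + 1) :=
      (hzlt k).trans_le (by gcongr)
    have hl' : g (z l) < m + 1 / ((N : ℝ) + 1) :=
      (hzlt l).trans_le (by gcongr)
    rw [h0, h1] at hc
    simp only [hg] at hmm hk' hl'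
    apply Real.le_sqrt_of_sq_le
    have h5 : dist (z k) (z l) ^ 2 / (2 * lam) ≤ 4 * (1 / ((N : ℝ) + 1)) := by linarith
    rw [div_le_iff₀ (by positivity)] at h5
    linarith
  have hlim0 : Tendsto (fun N : ℕ => 1 / ((N : ℝ) + 1)) atTop (𝓝 0) :=
    tendsto_one_div_add_atTop_nhds_zero_nat
  have hsq : Tendsto (fun N : ℕ => √(8 * lam * (1 / ((N : ℝ) + 1)))) atTop (𝓝 0) := by
    have := (hlim0.const_mul (8 * lam)).sqrt
    simpa using this
  have hcau : CauchySeq z := cauchySeq_of_le_tendsto_0 _ (fun k l N hk hl => hdist N k l hk hl) hsq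
  obtain ⟨y, hy⟩ := cauchySeq_tendsto_of_complete hcau
  have hdy : Tendsto (fun k => dist x (z k) ^ 2 / (2 * lam)) atTop
      (𝓝 (dist x y ^ 2 / (2 * lam))) := ((tendsto_const_nhds.dist hy).pow 2).div_const _
  have hfy : f y ≤ ((m + 0 - dist x y ^ 2 / (2 * lam) : ℝ) : EReal) := by
    refine hf.le_coe_of_tendsto hy ((tendsto_const_nhds.add hlim0).sub hdy) fun k => ?_
    rw [← hf.coe_toReal (hzD k)]
    have := hzlt k
    simp only [hg] at this
    exact EReal.coe_le_coe_iff.2 (by linarith)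
  obtain ⟨hyD, hyle⟩ := hf.mem_effDomain_and_le hfy
  refine ⟨y, hf.isProxPoint_iff.2 ⟨hyD, fun w hw => ?_⟩⟩
  have := hm w hw
  simp only [hg] at this
  linarith

/-- The variational inequality characterizing the resolvent. -/
lemma variational_inequality (hf : IsProperConvexLsc f) {lam : ℝ} (hlam : 0 < lam) {x y z : X}
    (hy : IsProxPoint f lam x y) (hz : z ∈ effDomain f) :
    (f y).toReal + dist x y ^ 2 / (2 * lam) + dist y z ^ 2 / (2 * lam) ≤
      (f z).toReal + dist x z ^ 2 / (2 * lam) := by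
  obtain ⟨hyD, hmin⟩ := hf.isProxPoint_iff.1 hy
  obtain ⟨γ, hγ, rfl, rfl⟩ := HadamardSpace.exists_geodesic y z
  refine add_le_of_forall_le_convex (by positivity) fun t ht => ?_
  have ht' : t ∈ Icc (0 : ℝ) 1 := ⟨ht.1.le, ht.2⟩
  exact (hmin _ (hf.convex_toReal hγ hyD hz ht').1).trans
    (hf.prox_strongly_convex hlam x hγ hyD hz ht')

lemma isProxPoint_unique (hf : IsProperConvexLsc f) {lam : ℝ} (hlam : 0 < lam) {x y z : X}
    (hy : IsProxPoint f lam x y) (hz : IsProxPoint f lam x z) : y = z := by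
  have h1 := hf.variational_inequality hlam hy (hf.isProxPoint_iff.1 hz).1
  have h2 := (hf.isProxPoint_iff.1 hz).2 y (hf.isProxPoint_iff.1 hy).1
  have h3 : dist y z ^ 2 / (2 * lam) ≤ 0 := by linarith
  rw [div_le_iff₀ (by positivity), zero_mul] at h3
  exact dist_eq_zero.1 (pow_eq_zero_iff two_ne_zero |>.1 (le_antisymm h3 (sq_nonneg _)))

/-! ### The resolvent -/

lemma isProxPoint_resolventMap (hf : IsProperConvexLsc f) {lam : ℝ} (hlam : 0 < lam) (x : X) :
    IsProxPoint f lam x (resolventMap f lam x) := by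
  have h : 0 < lam ∧ ∃ y, IsProxPoint f lam x y := ⟨hlam, hf.exists_isProxPoint hlam x⟩
  rw [resolventMap, dif_pos h]
  exact h.2.choose_spec

lemma resolventMap_eq (hf : IsProperConvexLsc f) {lam : ℝ} (hlam : 0 < lam) {x y : X}
    (hy : IsProxPoint f lam x y) : resolventMap f lam x = y :=
  hf.isProxPoint_unique hlam (hf.isProxPoint_resolventMap hlam x) hy

lemma resolventMap_mem (hf : IsProperConvexLsc f) {lam : ℝ} (hlam : 0 < lam) (x : X) :
    resolventMap f lam x ∈ effDomain f :=
  (hf.isProxPoint_iff.1 (hf.isProxPoint_resolventMap hlam x)).1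

/-- In the sum of the two variational inequalities, each tested at the other resolvent, the values
of `f` cancel; the quadrilateral inequality for `x, u, v, y` removes the diagonals. -/
lemma dist_resolventMap_le (hf : IsProperConvexLsc f) {lam : ℝ} (hlam : 0 < lam) (x y : X) :
    dist (resolventMap f lam x) (resolventMap f lam y) ≤ dist x y := by
  set u := resolventMap f lam x
  set v := resolventMap f lam y
  have h1 := hf.variational_inequality hlam (hf.isProxPoint_resolventMap hlam x)
    (hf.resolventMap_mem hlam y)
  have h2 := hf.variational_inequality hlam (hf.isProxPoint_resolventMap hlam y)
    (hf.resolventMap_mem hlam x)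
  have h3 := sq_dist_diagonals_le x u v y
  have h4 : (dist x u ^ 2 + dist u v ^ 2 + (dist y v ^ 2 + dist v u ^ 2)) / (2 * lam) ≤
      (dist x v ^ 2 + dist y u ^ 2) / (2 * lam) := by
    simp only [add_div]
    linarith
  rw [div_le_div_iff_of_pos_right (by positivity)] at h4
  rw [dist_comm v u, dist_comm y v, dist_comm y u] at h4
  exact le_of_sq_le_sq (by linarith) dist_nonneg

/-- The resolvent identity. -/
lemma resolventMap_geodesic (hf : IsProperConvexLsc f) {lam mu : ℝ} (hmu : 0 < mu)
    (hle : mu ≤ lam) {x : X} {γ : ℝ → X} (hγ : IsGeodesic γ) (h0 : γ 0 = resolventMap f lam x)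
    (h1 : γ 1 = x) : resolventMap f mu (γ (mu / lam)) = resolventMap f lam x := by
  have hlam : 0 < lam := hmu.trans_le hle
  refine hf.resolventMap_eq hmu (hf.isProxPoint_iff.2 ⟨hf.resolventMap_mem hlam x, fun z hz => ?_⟩)
  have hmin := (hf.isProxPoint_iff.1 (hf.isProxPoint_resolventMap hlam x)).2 z hz
  rw [← h0, ← h1] at *
  set α := mu / lam with hα
  have hα0 : 0 < α := by positivity
  have hα1 : α ≤ 1 := by rw [hα, div_le_one hlam]; exact hle
  have hmu' : mu = α * lam := by rw [hα]; field_simp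
  have hd0 := hγ.dist_zero ⟨hα0.le, hα1⟩
  have hd1 := hγ.dist_one ⟨hα0.le, hα1⟩
  have htri := dist_triangle_left (γ 1) z (γ α)
  rw [hd1] at htri
  rw [dist_comm (γ α) (γ 0), hd0]
  rw [dist_comm (γ 1) (γ 0)] at hmin
  set D := dist (γ 0) (γ 1)
  set s := dist (γ α) z
  -- Only the triangle inequality is needed here: after squaring, the defect is exactly `(1 - α) (αD
  -- - s)²`.
  have hsq : α * dist (γ 1) z ^ 2 ≤ α * (1 - α) * D ^ 2 + s ^ 2 := by
    have h2 : dist (γ 1) z ^ 2 ≤ ((1 - α) * D + s) ^ 2 := pow_le_pow_left₀ dist_nonneg htri 2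
    have h3 : α * ((1 - α) * D + s) ^ 2 ≤ α * (1 - α) * D ^ 2 + s ^ 2 := by
      have h4 : 0 ≤ (1 - α) * (α * D - s) ^ 2 := mul_nonneg (by linarith) (sq_nonneg _)
      nlinarith
    exact (mul_le_mul_of_nonneg_left h2 hα0.le).trans h3
  have h5 : dist (γ 1) z ^ 2 / (2 * lam) ≤ ((1 - α) * D ^ 2 + s ^ 2 / α) / (2 * lam) := by
    gcongr
    rw [← mul_le_mul_iff_right₀ hα0]
    refine hsq.trans (le_of_eq ?_)
    field_simp
  have h6 : ((1 - α) * D ^ 2 + s ^ 2 / α) / (2 * lam) =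
      D ^ 2 / (2 * lam) - (α * D) ^ 2 / (2 * mu) + s ^ 2 / (2 * mu) := by
    rw [hmu']; field_simp
  linarith

end IsProperConvexLsc

end SingleSpace

end HadamardFlow

/-! ### The exponential formula and its error. -/

namespace HadamardFlow

section Semigroup

universe u

variable {X : Type u} [MetricSpace X] [HadamardSpace X] {f : X → EReal}

namespace IsProperConvexLsc

/-! ### Estimates for iterated resolvents -/

lemma dist_iterate_le (hf : IsProperConvexLsc f) {lam : ℝ} (hlam : 0 < lam) (k : ℕ) (x y : X) :
    dist ((resolventMap f lam)^[k] x) ((resolventMap f lam)^[k] y) ≤ dist x y := by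
  induction k with
  | zero => simp
  | succ k ih =>
    simp only [Function.iterate_succ_apply']
    exact (hf.dist_resolventMap_le hlam _ _).trans ih

lemma dist_iterate_self_le (hf : IsProperConvexLsc f) {lam : ℝ} (hlam : 0 < lam) (k : ℕ) (x : X) :
    dist ((resolventMap f lam)^[k] x) x ≤ k * dist x (resolventMap f lam x) := by
  induction k with
  | zero => simp
  | succ k ih =>
    have h1 := hf.dist_iterate_le hlam k (resolventMap f lam x) x
    rw [← Function.iterate_succ_apply, dist_comm (resolventMap f lam x) x] at h1
    have h2 := dist_triangle ((resolventMap f lam)^[k + 1] x) ((resolventMap f lam)^[k] x) x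
    push_cast
    linarith

/-- By the resolvent identity `J_λ x` is also `J_μ` of a point on the geodesic from `J_λ x` to `x`;
nonexpansiveness of `J_μ` and CAT(0) along this geodesic give the one-step recursion for the
Crandall–Liggett estimate. -/
lemma sq_dist_resolventMap_le (hf : IsProperConvexLsc f) {lam mu : ℝ} (hmu : 0 < mu)
    (hle : mu ≤ lam) (x y : X) :
    dist (resolventMap f lam x) (resolventMap f mu y) ^ 2 ≤
      (1 - mu / lam) * dist (resolventMap f lam x) y ^ 2 + mu / lam * dist x y ^ 2 := by
  have hlam : 0 < lam := hmu.trans_le hle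
  obtain ⟨γ, hγ, h0, h1⟩ := HadamardSpace.exists_geodesic (resolventMap f lam x) x
  have hα : mu / lam ∈ Icc (0 : ℝ) 1 := ⟨by positivity, by rwa [div_le_one hlam]⟩
  have h2 := hf.dist_resolventMap_le hmu (γ (mu / lam)) y
  rw [hf.resolventMap_geodesic hmu hle hγ h0 h1] at h2
  have h3 := HadamardSpace.cat_zero y γ hγ _ hα
  rw [h0, h1, dist_comm y (γ _), dist_comm y (resolventMap f lam x), dist_comm y x] at h3
  have h4 : 0 ≤ mu / lam * (1 - mu / lam) * dist (resolventMap f lam x) x ^ 2 :=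
    mul_nonneg (mul_nonneg hα.1 (by linarith [hα.2])) (sq_nonneg _)
  have h5 := pow_le_pow_left₀ dist_nonneg h2 2
  linarith

/-- The Yosida-type bound on the displacement of a point in the range of the resolvent. -/
lemma dist_resolventMap_resolventMap_le (hf : IsProperConvexLsc f) {lam nu : ℝ} (hlam : 0 < lam)
    (hle : lam ≤ nu) (x : X) :
    dist (resolventMap f nu x) (resolventMap f lam (resolventMap f nu x)) ≤
      lam * (dist x (resolventMap f nu x) / nu) := by
  have hnu : 0 < nu := hlam.trans_le hle
  obtain ⟨γ, hγ, h0, h1⟩ := HadamardSpace.exists_geodesic (resolventMap f nu x) x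
  have h2 := hf.dist_resolventMap_le hlam (γ (lam / nu)) (resolventMap f nu x)
  rw [hf.resolventMap_geodesic hlam hle hγ h0 h1, ← h0, dist_comm _ (γ 0),
    hγ.dist_zero ⟨by positivity, by rwa [div_le_one hnu]⟩, h1, h0, dist_comm _ x] at h2
  refine h2.trans (le_of_eq (by ring))

/-- The Crandall–Liggett estimate. -/
lemma sq_dist_iterate_iterate_le (hf : IsProperConvexLsc f) {lam mu K : ℝ} (hmu : 0 < mu)
    (hle : mu ≤ lam) {y : X} (h1 : dist y (resolventMap f lam y) ≤ lam * K)
    (h2 : dist y (resolventMap f mu y) ≤ mu * K) (n m : ℕ) :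
    dist ((resolventMap f lam)^[m] y) ((resolventMap f mu)^[n] y) ^ 2 ≤
      K ^ 2 * ((m * lam - n * mu) ^ 2 + n * mu * (lam - mu)) := by
  have hlam : 0 < lam := hmu.trans_le hle
  induction n generalizing m with
  | zero =>
    have h3 := hf.dist_iterate_self_le hlam m y
    have h4 : dist ((resolventMap f lam)^[m] y) y ≤ m * (lam * K) :=
      h3.trans (mul_le_mul_of_nonneg_left h1 (Nat.cast_nonneg m))
    have h5 := pow_le_pow_left₀ dist_nonneg h4 2
    simp only [Function.iterate_zero, id_eq, Nat.cast_zero]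
    refine h5.trans (le_of_eq (by ring))
  | succ n ih =>
    cases m with
    | zero =>
      have h3 := hf.dist_iterate_self_le hmu (n + 1) y
      have h4 : dist ((resolventMap f mu)^[n + 1] y) y ≤ (n + 1 : ℕ) * (mu * K) :=
        h3.trans (mul_le_mul_of_nonneg_left h2 (Nat.cast_nonneg _))
      have h5 := pow_le_pow_left₀ dist_nonneg h4 2
      rw [Function.iterate_zero, id_eq, dist_comm]
      have h6 : 0 ≤ K ^ 2 * ((n + 1 : ℕ) * mu * (lam - mu)) :=
        mul_nonneg (sq_nonneg K) (mul_nonneg (by positivity) (by linarith))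
      refine h5.trans ?_
      push_cast at *
      nlinarith
    | succ m =>
      have h3 := hf.sq_dist_resolventMap_le hmu hle ((resolventMap f lam)^[m] y)
        ((resolventMap f mu)^[n] y)
      rw [← Function.iterate_succ_apply' (resolventMap f lam),
        ← Function.iterate_succ_apply' (resolventMap f mu)] at h3
      have hα0 : 0 ≤ mu / lam := by positivity
      have hα1 : 0 ≤ 1 - mu / lam := by rw [sub_nonneg, div_le_one hlam]; exact hle
      -- The claimed bound solves the recursion with equality, so only an algebraic identity
      -- remains.
      refine h3.trans ((add_le_add (mul_le_mul_of_nonneg_left (ih (m + 1)) hα1)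
        (mul_le_mul_of_nonneg_left (ih m) hα0)).trans (le_of_eq ?_))
      push_cast
      field_simp
      ring

/-- With total time `t` on both sides the term `(mλ - nμ)²` vanishes and `t (t/k - t/l) ≤ t²/k` is
left. Starting in the range of `J_ν` supplies the constant `K = d(x,y)/ν` for both step sizes. -/
lemma dist_iterate_div_le (hf : IsProperConvexLsc f) {nu t : ℝ} (ht : 0 < t)
    {x y : X} (hy : y = resolventMap f nu x) {k l : ℕ} (hk : 0 < k) (hkl : k ≤ l)
    (hnu : t / k ≤ nu) :
    dist ((resolventMap f (t / k))^[k] y) ((resolventMap f (t / l))^[l] y) ≤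
      dist x y / nu * (t / √k) := by
  have hk' : (0 : ℝ) < k := Nat.cast_pos.2 hk
  have hl' : (0 : ℝ) < l := Nat.cast_pos.2 (hk.trans_le hkl)
  have hlk : t / l ≤ t / k := by gcongr
  have htk : 0 < t / k := by positivity
  have htl : 0 < t / l := by positivity
  have hnu0 : 0 < nu := htk.trans_le hnu
  have h1 := hf.dist_resolventMap_resolventMap_le htk hnu x
  have h2 := hf.dist_resolventMap_resolventMap_le htl (hlk.trans hnu) x
  rw [← hy] at h1 h2
  have h3 := hf.sq_dist_iterate_iterate_le htl hlk h1 h2 l k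
  refine le_of_sq_le_sq (h3.trans ?_) (by positivity)
  rw [mul_pow]
  refine mul_le_mul_of_nonneg_left ?_ (sq_nonneg _)
  rw [div_pow, Real.sq_sqrt hk'.le, mul_div_cancel₀ _ hk'.ne', mul_div_cancel₀ _ hl'.ne', sub_self]
  have h4 : t * (t / k - t / l) = t ^ 2 / k - t ^ 2 / l := by ring
  have h5 : 0 ≤ t ^ 2 / l := by positivity
  rw [h4]
  linarith

/-! ### Resolvents with small parameter -/

/-- Adding the two variational inequalities gives `(λ + μ) e ≤ (λ - μ)(a - b)`, where `a`, `b` are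
the squared displacements and `e` the squared distance. In particular the displacement is monotone
in the parameter. -/
lemma sq_dist_resolventMap_resolventMap_le (hf : IsProperConvexLsc f) {lam mu : ℝ} (hmu : 0 < mu)
    (hle : mu ≤ lam) (x : X) :
    dist (resolventMap f lam x) (resolventMap f mu x) ^ 2 ≤
      dist x (resolventMap f lam x) ^ 2 - dist x (resolventMap f mu x) ^ 2 := by
  have hlam : 0 < lam := hmu.trans_le hle
  have h1 := hf.variational_inequality hlam (hf.isProxPoint_resolventMap hlam x)
    (hf.resolventMap_mem hmu x)
  have h2 := hf.variational_inequality hmu (hf.isProxPoint_resolventMap hmu x)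
    (hf.resolventMap_mem hlam x)
  rw [dist_comm (resolventMap f mu x) (resolventMap f lam x)] at h2
  set a := dist x (resolventMap f lam x) ^ 2
  set b := dist x (resolventMap f mu x) ^ 2
  set e := dist (resolventMap f lam x) (resolventMap f mu x) ^ 2 with he
  have he0 : 0 ≤ e := sq_nonneg _
  have h3 : (a + e - b) / (2 * lam) + (b + e - a) / (2 * mu) ≤ 0 := by
    simp only [sub_div, add_div]
    linarith
  have h4 : ((a + e - b) / (2 * lam) + (b + e - a) / (2 * mu)) * (2 * lam * mu) =
      (a + e - b) * mu + (b + e - a) * lam := by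
    field_simp
  have h5 : (a + e - b) * mu + (b + e - a) * lam ≤ 0 := by
    rw [← h4]
    exact mul_nonpos_of_nonpos_of_nonneg h3 (by positivity)
  rcases hle.eq_or_lt with rfl | hlt
  · nlinarith
  · by_contra hcon
    push Not at hcon
    nlinarith

/-- The resolvents `J_λ x` form a Cauchy net as `λ → 0`. -/
lemma exists_dist_resolventMap_le (hf : IsProperConvexLsc f) (x : X) {ε : ℝ} (hε : 0 < ε) :
    ∃ nu > 0, ∀ lam, 0 < lam → lam ≤ nu →
      dist (resolventMap f lam x) (resolventMap f nu x) ≤ ε := by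
  set S := (fun lam => dist x (resolventMap f lam x) ^ 2) '' Ioi (0 : ℝ)
  have hbdd : BddBelow S := ⟨0, by rintro _ ⟨lam, -, rfl⟩; positivity⟩
  -- For `nu` within `ε²` of the infimal squared displacement, smaller parameters can lower it by
  -- less than `ε²`.
  obtain ⟨_, ⟨nu, hnu, rfl⟩, hlt⟩ := exists_lt_of_csInf_lt (s := S) (nonempty_Ioi.image _)
    (lt_add_of_pos_right (sInf S) (by positivity : 0 < ε ^ 2))
  refine ⟨nu, hnu, fun lam hlam hle => le_of_sq_le_sq ?_ hε.le⟩
  have h1 := hf.sq_dist_resolventMap_resolventMap_le hlam hle x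
  have h2 : sInf S ≤ dist x (resolventMap f lam x) ^ 2 := csInf_le hbdd (mem_image_of_mem _ hlam)
  rw [dist_comm]
  simp only at hlt
  linarith

/-- On the closure of the domain, `J_λ x → x` as `λ → 0`. -/
lemma exists_dist_resolventMap_self_lt (hf : IsProperConvexLsc f) {x : X}
    (hx : x ∈ closure (effDomain f)) {ε : ℝ} (hε : 0 < ε) :
    ∃ nu > 0, dist x (resolventMap f nu x) < ε := by
  obtain ⟨z, hz, hxz⟩ := Metric.mem_closure_iff.1 hx ε hε
  -- For `ν ≤ 1` one has `f (J_1 x) ≤ f (J_ν x)`, so `A` bounds `f z - f (J_ν x)` uniformly in `ν`.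
  set A := (f z).toReal - (f (resolventMap f 1 x)).toReal
  have hlim : Tendsto (fun nu : ℝ => dist x z ^ 2 + 2 * nu * A) (𝓝[>] 0) (𝓝 (dist x z ^ 2)) := by
    have h : Tendsto (fun nu : ℝ => dist x z ^ 2 + 2 * nu * A) (𝓝 0)
        (𝓝 (dist x z ^ 2 + 2 * 0 * A)) := by
      apply Continuous.tendsto'
      · fun_prop
      · rfl
    rw [mul_zero, zero_mul, add_zero] at h
    exact h.mono_left nhdsWithin_le_nhds
  have hlt : dist x z ^ 2 < ε ^ 2 := pow_lt_pow_left₀ hxz dist_nonneg two_ne_zero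
  obtain ⟨nu, hnu, hnu0, hnu1⟩ := ((hlim.eventually_lt_const hlt).and
    (Ioc_mem_nhdsGT (zero_lt_one' ℝ))).exists
  refine ⟨nu, hnu0, lt_of_pow_lt_pow_left₀ 2 hε.le (lt_of_le_of_lt ?_ hnu)⟩
  have h1 := (hf.isProxPoint_iff.1 (hf.isProxPoint_resolventMap hnu0 x)).2 z hz
  have h2 := hf.variational_inequality one_pos (hf.isProxPoint_resolventMap one_pos x)
    (hf.resolventMap_mem hnu0 x)
  have h3 := hf.sq_dist_resolventMap_resolventMap_le hnu0 hnu1 x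
  have h4 : dist x (resolventMap f nu x) ^ 2 / (2 * nu) ≤ A + dist x z ^ 2 / (2 * nu) := by
    nlinarith [sq_nonneg (dist (resolventMap f 1 x) (resolventMap f nu x))]
  have h5 : (A + dist x z ^ 2 / (2 * nu)) = (dist x z ^ 2 + 2 * nu * A) / (2 * nu) := by
    have : nu ≠ 0 := hnu0.ne'
    field_simp
    ring
  rwa [h5, div_le_div_iff_of_pos_right (by linarith)] at h4

/-! ### The semigroup -/

lemma exists_isSemigroupLimit (hf : IsProperConvexLsc f) {t : ℝ} (ht : 0 < t) (x : X) :
    ∃ y, IsSemigroupLimit f t x y := by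
  refine cauchySeq_tendsto_of_complete (Metric.cauchySeq_iff'.2 fun ε hε => ?_)
  obtain ⟨nu, hnu, hnear⟩ := hf.exists_dist_resolventMap_le x (by positivity : 0 < ε / 8)
  set y := resolventMap f nu x with hy
  have hlim1 : Tendsto (fun k : ℕ => t / k) atTop (𝓝 0) := tendsto_const_div_atTop_nhds_zero_nat t
  have hlim2 : Tendsto (fun k : ℕ => t / k * (dist x y / nu)) atTop (𝓝 0) := by
    simpa using hlim1.mul_const (dist x y / nu)
  have hlim3 : Tendsto (fun k : ℕ => dist x y / nu * (t / √k)) atTop (𝓝 0) := by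
    have : Tendsto (fun k : ℕ => t / √k) atTop (𝓝 0) :=
      tendsto_const_nhds.div_atTop (Real.tendsto_sqrt_atTop.comp tendsto_natCast_atTop_atTop)
    simpa using this.const_mul (dist x y / nu)
  obtain ⟨N, hN⟩ := eventually_atTop.1 ((hlim1.eventually_le_const hnu).and
    ((hlim2.eventually_le_const (by positivity : 0 < ε / 8)).and
      ((hlim3.eventually_le_const (by positivity : 0 < ε / 8)).and (eventually_gt_atTop 0))))
  have hclose : ∀ k ≥ N,
      dist ((resolventMap f (t / k))^[k] x) ((resolventMap f (t / k))^[k] y) ≤ ε / 4 := by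
    intro k hk
    obtain ⟨h1, h2, -, h3⟩ := hN k hk
    -- One step is split off because `x` may be far from `y` when it lies outside the closure of the
    -- domain. After that step both points are near `y`, and the other `j` steps are nonexpansive.
    obtain ⟨j, rfl⟩ := Nat.exists_eq_add_one_of_ne_zero h3.ne'
    have hpos : 0 < t / (j + 1 : ℕ) := by positivity
    have h4 := hf.dist_iterate_le hpos j (resolventMap f (t / (j + 1 : ℕ)) x)
      (resolventMap f (t / (j + 1 : ℕ)) y)
    simp only [← Function.iterate_succ_apply] at h4
    have h5 := hnear _ hpos h1
    have h6 := hf.dist_resolventMap_resolventMap_le hpos h1 x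
    rw [← hy] at h6
    have h7 := dist_triangle (resolventMap f (t / (j + 1 : ℕ)) x) y
      (resolventMap f (t / (j + 1 : ℕ)) y)
    refine h4.trans ?_
    linarith
  refine ⟨N, fun l hl => ?_⟩
  obtain ⟨h1, -, h3, h4⟩ := hN N le_rfl
  have h5 := hf.dist_iterate_div_le ht hy h4 hl h1
  have h6 := hclose N le_rfl
  have h7 := hclose l hl
  rw [dist_comm] at h5
  have h8 := dist_triangle4 ((resolventMap f (t / l))^[l] x) ((resolventMap f (t / l))^[l] y)
    ((resolventMap f (t / N))^[N] y) ((resolventMap f (t / N))^[N] x)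
  rw [dist_comm ((resolventMap f (t / N))^[N] x)] at h6
  linarith

lemma isSemigroupLimit_semigroupMap (hf : IsProperConvexLsc f) {t : ℝ} (ht : 0 < t) (x : X) :
    IsSemigroupLimit f t x (semigroupMap f t x) := by
  have h := hf.exists_isSemigroupLimit ht x
  rw [semigroupMap, dif_pos h]
  exact h.choose_spec

/-- The error estimate for the exponential formula. -/
lemma dist_iterate_semigroupMap_le (hf : IsProperConvexLsc f) {nu t : ℝ} (ht : 0 < t) (x : X)
    {k : ℕ} (hk : 0 < k) (hnu : t / k ≤ nu) :
    dist ((resolventMap f (t / k))^[k] x) (semigroupMap f t x) ≤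
      2 * dist x (resolventMap f nu x) + dist x (resolventMap f nu x) / nu * (t / √k) := by
  -- Compare the `k`-th with the `l`-th approximation through the iterates of `J_ν x`, and let `l →
  -- ∞`.
  refine le_of_tendsto (tendsto_const_nhds.dist (hf.isSemigroupLimit_semigroupMap ht x)) ?_
  filter_upwards [eventually_ge_atTop k] with l hl
  set y := resolventMap f nu x with hy
  have hk' : (0 : ℝ) < k := Nat.cast_pos.2 hk
  have hl' : (0 : ℝ) < l := Nat.cast_pos.2 (hk.trans_le hl)
  have h1 := hf.dist_iterate_div_le ht hy hk hl hnu
  have h2 := hf.dist_iterate_le (div_pos ht hk') k x y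
  have h3 := hf.dist_iterate_le (div_pos ht hl') l y x
  rw [dist_comm y x] at h3
  have h4 := dist_triangle4 ((resolventMap f (t / k))^[k] x) ((resolventMap f (t / k))^[k] y)
    ((resolventMap f (t / l))^[l] y) ((resolventMap f (t / l))^[l] x)
  linarith

theorem resolventAndSemigroupWellDefined (hf : IsProperConvexLsc f) :
    ResolventAndSemigroupWellDefined f :=
  ⟨fun _ x hlam => existsUnique_of_exists_of_unique (hf.exists_isProxPoint hlam x)
    fun _ _ => hf.isProxPoint_unique hlam, fun _ x ht => hf.exists_isSemigroupLimit ht x⟩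

end IsProperConvexLsc

end Semigroup

end HadamardFlow

/-! ### A diagonal argument with filters in place of subsequences. -/

namespace HadamardFlow

/-- A monotone nonnegative functional on filters becomes constant on all finer filters after
passing to a suitable countably generated finer filter. -/
lemma exists_regular_filter {α : Type*} {F₀ : Filter α} [F₀.NeBot] [F₀.IsCountablyGenerated]
    (ρ : Filter α → ℝ) (h0 : ∀ F, 0 ≤ ρ F) (hmono : ∀ F G, F ≤ F₀ → G ≤ F → ρ G ≤ ρ F) :
    ∃ F ≤ F₀, F.NeBot ∧ F.IsCountablyGenerated ∧
      ∀ G ≤ F, G.NeBot → G.IsCountablyGenerated → ρ G = ρ F := by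
  let T := {F : Filter α // F ≤ F₀ ∧ F.NeBot ∧ F.IsCountablyGenerated}
  -- At stage `k` the value is brought within `1/(k+1)` of the infimum over finer filters; the
  -- infimum of the resulting chain plays the diagonal subsequence.
  have hstep : ∀ (k : ℕ) (F : T), ∃ F' : T, F'.1 ≤ F.1 ∧
      ∀ G : T, G.1 ≤ F.1 → ρ F'.1 ≤ ρ G.1 + 1 / ((k : ℝ) + 1) := by
    intro k F
    set S := (fun G : T => ρ G.1) '' {G | G.1 ≤ F.1}
    have hbdd : BddBelow S := ⟨0, by rintro _ ⟨G, -, rfl⟩; exact h0 _⟩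
    have hne : S.Nonempty := ⟨_, F, le_refl F.1, rfl⟩
    obtain ⟨_, ⟨F', hF', rfl⟩, hlt⟩ := exists_lt_of_csInf_lt hne
      (lt_add_of_pos_right (sInf S) (by positivity : (0 : ℝ) < 1 / ((k : ℝ) + 1)))
    refine ⟨F', hF', fun G hG => ?_⟩
    have h1 : sInf S ≤ ρ G.1 := csInf_le hbdd ⟨G, hG, rfl⟩
    simp only at hlt
    linarith
  choose next hnext_le hnext using hstep
  let seq : ℕ → T := fun k =>
    Nat.rec ⟨F₀, le_rfl, inferInstance, inferInstance⟩ (fun k F => next k F) k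
  have hseq : ∀ k, seq (k + 1) = next k (seq k) := fun k => rfl
  have hanti : Antitone fun k => (seq k).1 := antitone_nat_of_succ_le fun k => by
    rw [hseq]; exact hnext_le k _
  have hcg : (⨅ k, (seq k).1).IsCountablyGenerated := by
    have := fun k => (seq k).2.2.2
    infer_instance
  have hnb : (⨅ k, (seq k).1).NeBot := by
    have := fun k => (seq k).2.2.1
    exact iInf_neBot_of_directed' hanti.directed_ge this
  have hle : (⨅ k, (seq k).1) ≤ F₀ := iInf_le (fun k => (seq k).1) 0
  refine ⟨_, hle, hnb, hcg, fun G hG hGn hGc => le_antisymm (hmono _ _ hle hG) ?_⟩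
  have key : ∀ k : ℕ, ρ (⨅ k, (seq k).1) ≤ ρ G + 1 / ((k : ℝ) + 1) := fun k => by
    have h1 := hnext k (seq k) ⟨G, hG.trans hle, hGn, hGc⟩ (hG.trans (iInf_le _ k))
    rw [← hseq] at h1
    exact (hmono _ _ (seq (k + 1)).2.1 (iInf_le _ (k + 1))).trans h1
  have hlim : Tendsto (fun k : ℕ => ρ G + 1 / ((k : ℝ) + 1)) atTop (𝓝 (ρ G + 0)) :=
    tendsto_const_nhds.add tendsto_one_div_add_atTop_nhds_zero_nat
  rw [add_zero] at hlim
  exact ge_of_tendsto' hlim key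

/-! ### Asymptotic radii, asymptotic centers and weak compactness. -/

section VaryingSpaces

universe u v

variable {Xs : ℕ → Type v} {X : Type u} [∀ n, MetricSpace (Xs n)] [MetricSpace X]
  [TopologicalSpace (TotalSpace Xs X)]

/-- The numbers `s` such that, along `F`, the sequence `ys` stays at distance at most `s` from
some convergent sequence. -/
def asymptoticRadii (X : Type u) [MetricSpace X] [TopologicalSpace (TotalSpace Xs X)]
    (ys : ∀ n, Xs n) (F : Filter ℕ) : Set ℝ :=
  {s | 0 ≤ s ∧ ∃ (zs : ∀ n, Xs n) (z : X), ConvergesTo zs z ∧ ∀ᶠ n in F, dist (ys n) (zs n) ≤ s}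

/-- The asymptotic radius of the sequence `ys` along `F`. -/
noncomputable def asymptoticRadius (X : Type u) [MetricSpace X]
    [TopologicalSpace (TotalSpace Xs X)] (ys : ∀ n, Xs n) (F : Filter ℕ) : ℝ :=
  sInf (asymptoticRadii X ys F)

lemma asymptoticRadius_nonneg (ys : ∀ n, Xs n) (F : Filter ℕ) : 0 ≤ asymptoticRadius X ys F :=
  Real.sInf_nonneg fun _ hs => hs.1

lemma asymptoticRadius_le {ys : ∀ n, Xs n} {F : Filter ℕ} {s : ℝ}
    (hs : s ∈ asymptoticRadii X ys F) : asymptoticRadius X ys F ≤ s :=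
  csInf_le ⟨0, fun _ h => h.1⟩ hs

lemma asymptoticRadii_mono (ys : ∀ n, Xs n) {F G : Filter ℕ} (h : G ≤ F) :
    asymptoticRadii X ys F ⊆ asymptoticRadii X ys G :=
  fun _ ⟨h0, zs, z, hz, hF⟩ => ⟨h0, zs, z, hz, hF.filter_mono h⟩

lemma asymptoticRadius_mono {ys : ∀ n, Xs n} {F G : Filter ℕ} (h : G ≤ F)
    (hne : (asymptoticRadii X ys F).Nonempty) :
    asymptoticRadius X ys G ≤ asymptoticRadius X ys F :=
  csInf_le_csInf ⟨0, fun _ h => h.1⟩ hne (asymptoticRadii_mono ys h)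

namespace IsAsymptoticRelation

lemma tendsto_dist_zero (hrel : IsAsymptoticRelation Xs X) {xs ys : ∀ n, Xs n} {x : X}
    (hx : ConvergesTo xs x) (hy : ConvergesTo ys x) :
    Tendsto (fun n => dist (xs n) (ys n)) atTop (𝓝 0) := by
  simpa using hrel.tendsto_dist xs ys x x hx hy

lemma dist_bounded (hrel : IsAsymptoticRelation Xs X) {xs ys : ∀ n, Xs n} {x y : X}
    (hx : ConvergesTo xs x) (hy : ConvergesTo ys y) : ∃ R, ∀ n, dist (xs n) (ys n) ≤ R := by
  obtain ⟨R, hR⟩ := (hrel.tendsto_dist _ _ _ _ hx hy).bddAbove_range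
  exact ⟨R, fun n => hR (mem_range_self n)⟩

variable [∀ n, HadamardSpace (Xs n)]

/-- CAT(0) is an equality for a point of the geodesic itself, so the bound for the distance from
points approximating `γ t` to `γs n t` tends to zero. -/
lemma convergesTo_geodesic (hrel : IsAsymptoticRelation Xs X) {γs : ∀ n, ℝ → Xs n} {γ : ℝ → X}
    (hγs : ∀ n, IsGeodesic (γs n)) (hγ : IsGeodesic γ)
    (h0 : ConvergesTo (fun n => γs n 0) (γ 0)) (h1 : ConvergesTo (fun n => γs n 1) (γ 1))
    {t : ℝ} (ht : t ∈ Icc (0 : ℝ) 1) : ConvergesTo (fun n => γs n t) (γ t) := by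
  obtain ⟨zs, hzs⟩ := hrel.exists_converging (γ t)
  refine hrel.converges_of_dist zs _ _ hzs ?_
  have hlim := ((((hrel.tendsto_dist _ _ _ _ hzs h0).pow 2).const_mul (1 - t)).add
    (((hrel.tendsto_dist _ _ _ _ hzs h1).pow 2).const_mul t)).sub
    (((hrel.tendsto_dist _ _ _ _ h0 h1).pow 2).const_mul (t * (1 - t)))
  have hzero : (1 - t) * dist (γ t) (γ 0) ^ 2 + t * dist (γ t) (γ 1) ^ 2 -
      t * (1 - t) * dist (γ 0) (γ 1) ^ 2 = 0 := by
    rw [dist_comm (γ t) (γ 0), hγ.dist_zero ht, hγ.dist_one ht]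
    ring
  rw [hzero] at hlim
  have hsq : Tendsto (fun n => dist (zs n) (γs n t) ^ 2) atTop (𝓝 0) :=
    squeeze_zero (fun n => sq_nonneg _)
      (fun n => HadamardSpace.cat_zero (zs n) (γs n) (hγs n) t ht) hlim
  simpa [Real.sqrt_sq] using hsq.sqrt

variable [HadamardSpace X]

/-- The parallelogram-type inequality behind the uniqueness of asymptotic centers. -/
lemma sq_asymptoticRadius_add_le (hrel : IsAsymptoticRelation Xs X) {F : Filter ℕ} [F.NeBot]
    (hF : F ≤ atTop) {ys zs zs' : ∀ n, Xs n} {z z' : X} {s : ℝ} (hz : ConvergesTo zs z)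
    (hz' : ConvergesTo zs' z') (hs : ∀ᶠ n in F, dist (ys n) (zs n) ≤ s)
    (hs' : ∀ᶠ n in F, dist (ys n) (zs' n) ≤ s) :
    asymptoticRadius X ys F ^ 2 + dist z z' ^ 2 / 4 ≤ s ^ 2 := by
  refine le_of_forall_pos_le_add fun η hη => ?_
  choose γs hγs hγs0 hγs1 using fun n => HadamardSpace.exists_geodesic (zs n) (zs' n)
  obtain ⟨γ, hγ, hγ0, hγ1⟩ := HadamardSpace.exists_geodesic z z'
  have hh : (1 / 2 : ℝ) ∈ Icc (0 : ℝ) 1 := by norm_num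
  have hmid := hrel.convergesTo_geodesic hγs hγ (by simpa only [hγs0, hγ0] using hz)
    (by simpa only [hγs1, hγ1] using hz') hh
  have hd : ∀ᶠ n in F, dist z z' ^ 2 - 4 * η < dist (zs n) (zs' n) ^ 2 :=
    (((hrel.tendsto_dist _ _ _ _ hz hz').pow 2).eventually_const_lt (by linarith)).filter_mono hF
  set Q := s ^ 2 - dist z z' ^ 2 / 4 + η
  have hQ : ∀ᶠ n in F, dist (ys n) (γs n (1 / 2)) ^ 2 ≤ Q := by
    filter_upwards [hs, hs', hd] with n h1 h2 h3
    have h4 := HadamardSpace.cat_zero (ys n) (γs n) (hγs n) _ hh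
    rw [hγs0, hγs1] at h4
    have h5 := pow_le_pow_left₀ dist_nonneg h1 2
    have h6 := pow_le_pow_left₀ dist_nonneg h2 2
    simp only [Q]
    linarith
  have hQ0 : 0 ≤ Q := by
    obtain ⟨n, hn⟩ := hQ.exists
    exact (sq_nonneg _).trans hn
  have h1 : asymptoticRadius X ys F ≤ √Q := asymptoticRadius_le
    ⟨Real.sqrt_nonneg _, _, _, hmid, hQ.mono fun n hn => Real.le_sqrt_of_sq_le hn⟩
  have h2 := pow_le_pow_left₀ (asymptoticRadius_nonneg ys F) h1 2
  rw [Real.sq_sqrt hQ0] at h2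
  simp only [Q] at h2
  linarith

/-- Existence of asymptotic centers. -/
lemma exists_asymptoticCenter (hrel : IsAsymptoticRelation Xs X) {F : Filter ℕ} [F.NeBot]
    (hF : F ≤ atTop) {ys : ∀ n, Xs n} (hne : (asymptoticRadii X ys F).Nonempty) :
    ∃ c : X, ∀ cs : ∀ n, Xs n, ConvergesTo cs c → ∀ s > asymptoticRadius X ys F,
      ∀ᶠ n in F, dist (ys n) (cs n) ≤ s := by
  set ρ := asymptoticRadius X ys F with hρ
  have hex : ∀ k : ℕ, ∃ s ∈ asymptoticRadii X ys F, s < ρ + 1 / ((k : ℝ) + 1) := fun k =>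
    exists_lt_of_csInf_lt hne
      (lt_add_of_pos_right ρ (by positivity : (0 : ℝ) < 1 / ((k : ℝ) + 1)))
  choose s hs hslt using hex
  choose hs0 zs z hz hzF using hs
  have hlim0 : Tendsto (fun N : ℕ => 1 / ((N : ℝ) + 1)) atTop (𝓝 0) :=
    tendsto_one_div_add_atTop_nhds_zero_nat
  have hlim : Tendsto (fun N : ℕ => √(4 * ((ρ + 1 / ((N : ℝ) + 1)) ^ 2 - ρ ^ 2))) atTop (𝓝 0) := by
    have h := ((((hlim0.const_add ρ).pow 2).sub_const (ρ ^ 2)).const_mul 4).sqrt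
    simpa using h
  have hcau : CauchySeq z := by
    refine cauchySeq_of_le_tendsto_0 _ (fun k l N hk hl => ?_) hlim
    have hle : ∀ j, N ≤ j → ∀ᶠ n in F, dist (ys n) (zs j n) ≤ ρ + 1 / ((N : ℝ) + 1) := fun j hj =>
      (hzF j).mono fun n hn => hn.trans ((hslt j).le.trans (by gcongr))
    have h := hrel.sq_asymptoticRadius_add_le hF (hz k) (hz l) (hle k hk) (hle l hl)
    exact Real.le_sqrt_of_sq_le (by linarith)
  obtain ⟨c, hc⟩ := cauchySeq_tendsto_of_complete hcau
  refine ⟨c, fun cs hcs t ht => ?_⟩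
  have hpos : 0 < (t - ρ) / 2 := by linarith
  obtain ⟨k, hk1, hk2⟩ := ((hlim0.eventually_lt_const hpos).and
    (Metric.tendsto_nhds.1 hc _ hpos)).exists
  filter_upwards [hzF k, ((hrel.tendsto_dist _ _ _ _ (hz k) hcs).eventually_lt_const
    hk2).filter_mono hF] with n h1 h2
  have h3 := dist_triangle (ys n) (zs k n) (cs n)
  linarith [hslt k]

open Classical in
/-- Weak compactness of bounded sequences. -/
theorem exists_weaklyConvergesTo (hrel : IsAsymptoticRelation Xs X) {F₀ : Filter ℕ} [F₀.NeBot]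
    [F₀.IsCountablyGenerated] (hF₀ : F₀ ≤ atTop) {ys ws : ∀ n, Xs n} {p : X} {R : ℝ}
    (hw : ConvergesTo ws p) (hR : ∀ᶠ n in F₀, dist (ys n) (ws n) ≤ R) :
    ∃ G ≤ F₀, G.NeBot ∧ ∃ (c : X) (ys' : ∀ n, Xs n), WeaklyConvergesTo ys' c ∧
      ∀ᶠ n in G, ys' n = ys n := by
  have hR0 : 0 ≤ R := by
    obtain ⟨n, hn⟩ := hR.exists
    exact dist_nonneg.trans hn
  have hne : ∀ F ≤ F₀, (asymptoticRadii X ys F).Nonempty := fun F hF =>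
    ⟨R, hR0, ws, p, hw, hR.filter_mono hF⟩
  -- Along `F` the asymptotic radius can no longer drop; this makes the asymptotic center a weak
  -- limit.
  obtain ⟨F, hFF₀, hFn, hFc, hreg⟩ := exists_regular_filter (F₀ := F₀) (asymptoticRadius X ys)
    (fun F => asymptoticRadius_nonneg ys F)
    fun F G hF hG => asymptoticRadius_mono hG (hne F hF)
  have hF : F ≤ atTop := hFF₀.trans hF₀
  obtain ⟨c, hc⟩ := hrel.exists_asymptoticCenter hF (hne F hFF₀)
  set ρ := asymptoticRadius X ys F with hρ
  have hρ0 : 0 ≤ ρ := asymptoticRadius_nonneg ys F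
  obtain ⟨σ, hσ⟩ := F.exists_seq_tendsto
  set B : Set ℕ := {n | n ∈ range σ ∧ dist (ys n) (ws n) ≤ R} with hB
  -- Late indices in `B` are values `σ k` with `k` large, so statements along `F` hold at all of
  -- them.
  have hBF : atTop ⊓ 𝓟 B ≤ F := by
    intro U hU
    obtain ⟨K, hK⟩ := eventually_atTop.1 (hσ.eventually hU)
    rw [mem_inf_principal]
    obtain ⟨M, hM⟩ := ((Set.finite_Iio K).image σ).bddAbove
    filter_upwards [eventually_gt_atTop M] with n hn hnB
    obtain ⟨⟨k, rfl⟩, -⟩ := hnB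
    by_cases hk : K ≤ k
    · exact hK k hk
    · exact absurd (hM (mem_image_of_mem σ (not_le.1 hk))) (not_le.2 hn)
  obtain ⟨cs, hcs⟩ := hrel.exists_converging c
  -- Weak convergence concerns full sequences, so the indices outside `B` are filled with points
  -- converging strongly to `c`.
  refine ⟨map σ atTop, hσ.trans hFF₀, inferInstance, c, fun n => if n ∈ B then ys n else cs n,
    ⟨?_, ?_⟩, ?_⟩
  · obtain ⟨R', hR'⟩ := hrel.dist_bounded hw hcs
    refine ⟨cs, c, R + R', hcs, fun n => ?_⟩
    have hR'0 : 0 ≤ R' := dist_nonneg.trans (hR' n)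
    dsimp only
    split_ifs with hn
    · exact (dist_triangle _ (ws n) _).trans (add_le_add hn.2 (hR' n))
    · rw [dist_self]; positivity
  · intro γs γ hγs hγ hγ0 h0 h1
    set ps : ∀ n, Xs n := fun n =>
      metricProj (γs n '' Icc 0 1) (if n ∈ B then ys n else cs n) with hps
    have h0c : ConvergesTo (fun n => γs n 0) c := hγ0 ▸ h0
    refine hrel.converges_of_dist (fun n => γs n 0) ps c h0c ?_
    by_contra hcon
    rw [Metric.tendsto_nhds] at hcon
    push Not at hcon
    obtain ⟨ε, hε, hfreq⟩ := hcon
    have hmem0 : ∀ n, γs n 0 ∈ γs n '' Icc 0 1 := fun n => mem_image_of_mem _ (by simp)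
    -- Outside `B` the projected points are `cs n`, which approach `γs n 0`; their projections do
    -- too, so late bad indices lie in `B`.
    have hfreqB : ∃ᶠ n in atTop, n ∈ B ∧ ε ≤ dist (γs n 0) (ps n) := by
      refine (hfreq.and_eventually ((hrel.tendsto_dist_zero hcs h0c).eventually_lt_const
        (by positivity : 0 < ε / 2))).mono fun n ⟨hn1, hn2⟩ => ?_
      rw [Real.dist_0_eq_abs, abs_of_nonneg dist_nonneg] at hn1
      refine ⟨?_, hn1⟩
      by_contra hnB
      have h2 := (metricProj_geodesic_spec (hγs n) (cs n)).2 _ (hmem0 n)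
      simp only [hps, if_neg hnB] at hn1
      have h3 := dist_triangle_left (γs n 0) (metricProj (γs n '' Icc 0 1) (cs n)) (cs n)
      linarith
    have hG₁n : (atTop ⊓ 𝓟 {n | n ∈ B ∧ ε ≤ dist (γs n 0) (ps n)}).NeBot :=
      frequently_iff_neBot.1 hfreqB
    set G₁ := atTop ⊓ 𝓟 {n | n ∈ B ∧ ε ≤ dist (γs n 0) (ps n)} with hG₁
    have hG₁F : G₁ ≤ F :=
      (inf_le_inf_left _ (principal_mono.2 fun n hn => hn.1)).trans hBF
    have hG₁ev : ∀ᶠ n in G₁, n ∈ B ∧ ε ≤ dist (γs n 0) (ps n) :=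
      mem_inf_of_right (mem_principal_self _)
    choose s hsI hsp using fun n =>
      (metricProj_geodesic_spec (hγs n) (if n ∈ B then ys n else cs n)).1
    obtain ⟨a, haI, hacl⟩ := isCompact_Icc (f := map s G₁)
      (le_principal_iff.2 (mem_map.2 (Eventually.of_forall hsI)))
    have hG₂n : (comap s (𝓝 a) ⊓ G₁).NeBot := by
      rw [← map_neBot_iff s, Filter.push_pull']
      exact hacl
    set G₂ := comap s (𝓝 a) ⊓ G₁ with hG₂
    have hG₂F : G₂ ≤ F := inf_le_right.trans hG₁F
    have hsa : Tendsto s G₂ (𝓝 a) := tendsto_comap.mono_left inf_le_left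
    have hpa : Tendsto (fun n => dist (ps n) (γs n a)) G₂ (𝓝 0) := by
      have h2 : Tendsto (fun n => |s n - a| * dist (γs n 0) (γs n 1)) G₂
          (𝓝 (|a - a| * dist (γ 0) (γ 1))) :=
        ((hsa.sub_const a).abs).mul ((hrel.tendsto_dist _ _ _ _ h0 h1).mono_left (hG₂F.trans hF))
      rw [sub_self, abs_zero, zero_mul] at h2
      refine h2.congr fun n => ?_
      rw [← hγs n _ (hsI n) _ haI, hsp]
    have hγa := hrel.convergesTo_geodesic hγs hγ h0 h1 haI
    -- By Pythagoras, projections `ε` away from `γs n 0` are closer to `ys n` by a definite amount.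
    -- Since they accumulate at the convergent sequence `γs n a`, this would lower the radius along
    -- `G₂`.
    have key : ∀ δ > 0, 0 ≤ (ρ + δ) ^ 2 - ε ^ 2 ∧ ρ ≤ √((ρ + δ) ^ 2 - ε ^ 2) + δ := by
      intro δ hδ
      have hev : ∀ᶠ n in G₂, 0 ≤ (ρ + δ) ^ 2 - ε ^ 2 ∧
          dist (ys n) (γs n a) ≤ √((ρ + δ) ^ 2 - ε ^ 2) + δ := by
        filter_upwards [(hc _ h0c (ρ + δ) (by linarith)).filter_mono hG₂F,
          hpa.eventually_le_const hδ, hG₁ev.filter_mono inf_le_right] with n h2 h3 ⟨hnB, h4⟩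
        have h5 := sq_dist_metricProj_add_le (hγs n) (ys n) (hmem0 n)
        have hpn : ps n = metricProj (γs n '' Icc 0 1) (ys n) := by
          simp only [hps, if_pos hnB]
        rw [← hpn, dist_comm (ps n)] at h5
        have h6 := pow_le_pow_left₀ dist_nonneg h2 2
        have h7 := pow_le_pow_left₀ hε.le h4 2
        have h8 : dist (ys n) (ps n) ^ 2 ≤ (ρ + δ) ^ 2 - ε ^ 2 := by linarith
        exact ⟨(sq_nonneg _).trans h8, (dist_triangle _ (ps n) _).trans
          (add_le_add (Real.le_sqrt_of_sq_le h8) h3)⟩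
      refine ⟨hev.exists.choose_spec.1, ?_⟩
      refine (hreg G₂ hG₂F hG₂n inferInstance).symm.trans_le (asymptoticRadius_le ⟨by positivity, _, _, hγa,
        hev.mono fun n hn => hn.2⟩)
    -- The second bound makes `4ρδ < ε²`, contradicting `(ρ - δ)² ≤ (ρ + δ)² - ε²`; the first
    -- handles `ρ ≤ δ`, where `(ρ + δ)² < ε²`.
    have hδ : 0 < min (ε / 4) (ε ^ 2 / (8 * (ρ + 1))) := by positivity
    obtain ⟨h2, h3⟩ := key _ hδ
    have h4 := min_le_left (ε / 4) (ε ^ 2 / (8 * (ρ + 1)))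
    have h5 := min_le_right (ε / 4) (ε ^ 2 / (8 * (ρ + 1)))
    set δ := min (ε / 4) (ε ^ 2 / (8 * (ρ + 1)))
    rw [le_div_iff₀ (by positivity)] at h5
    rcases le_total ρ δ with h6 | h6
    · nlinarith
    · have h7 := pow_le_pow_left₀ (sub_nonneg.2 h6) (sub_le_iff_le_add.2 h3) 2
      rw [Real.sq_sqrt h2] at h7
      nlinarith [mul_nonneg hρ0 hδ.le]
  · have h2 : ∀ᶠ k in atTop, dist (ys (σ k)) (ws (σ k)) ≤ R :=
      (hσ.mono_right hFF₀).eventually hR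
    rw [eventually_map]
    filter_upwards [h2] with k hk
    rw [if_pos ⟨mem_range_self k, hk⟩]

end IsAsymptoticRelation

end VaryingSpaces

end HadamardFlow

/-! ### From Mosco convergence to resolvents, and from resolvents to semigroups. -/

namespace HadamardFlow

section VaryingSpaces

universe u v

variable {Xs : ℕ → Type v} {X : Type u} [∀ n, MetricSpace (Xs n)] [MetricSpace X]
  [TopologicalSpace (TotalSpace Xs X)]

/-- The Mosco lower bound in the form used with weak compactness: it holds for the filled-in
sequence `ys'` and is read off along `G`, where that agrees with `ys`. -/
lemma MoscoConvergesTo.le_of_tendsto {fs : ∀ n, Xs n → EReal} {f : X → EReal}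
    (hM : MoscoConvergesTo fs f) {ys ys' : ∀ n, Xs n} {c : X} (hc : WeaklyConvergesTo ys' c)
    {G : Filter ℕ} [G.NeBot] (hG : G ≤ atTop) (heq : ∀ᶠ n in G, ys' n = ys n) {b : ℕ → ℝ} {b₀ : ℝ}
    (hb : Tendsto b G (𝓝 b₀)) (hle : ∀ᶠ n in G, fs n (ys n) ≤ b n) : f c ≤ b₀ := by
  refine le_of_forall_lt fun q hq => ?_
  obtain ⟨q', hq1, hq2⟩ := exists_between hq
  have h1 : ∀ᶠ n in atTop, q' < fs n (ys' n) :=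
    eventually_lt_of_lt_liminf (hq2.trans_le (hM.le_liminf c ys' hc))
  have h2 : Tendsto (fun n => (b n : EReal)) G (𝓝 b₀) :=
    (continuous_coe_real_ereal.tendsto b₀).comp hb
  refine hq1.trans_le (ge_of_tendsto h2 ?_)
  filter_upwards [h1.filter_mono hG, heq, hle] with n h3 h4 h5
  rw [h4] at h3
  exact h3.le.trans h5

variable [∀ n, HadamardSpace (Xs n)] [HadamardSpace X]

/-- Weak lower semicontinuity of the distance. -/
lemma WeaklyConvergesTo.exists_tendsto_le_dist (hrel : IsAsymptoticRelation Xs X)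
    {xs ys : ∀ n, Xs n} {x y : X} (hx : ConvergesTo xs x) (hy : WeaklyConvergesTo ys y) :
    ∃ a : ℕ → ℝ, Tendsto a atTop (𝓝 (dist x y)) ∧ ∀ n, 0 ≤ a n ∧ a n ≤ dist (xs n) (ys n) := by
  obtain ⟨zs, hzs⟩ := hrel.exists_converging y
  choose γs hγs hγs0 hγs1 using fun n => HadamardSpace.exists_geodesic (zs n) (xs n)
  obtain ⟨γ, hγ, hγ0, hγ1⟩ := HadamardSpace.exists_geodesic y x
  have hp := hy.proj γs γ hγs hγ hγ0 (by simpa only [hγs0, hγ0] using hzs)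
    (by simpa only [hγs1, hγ1] using hx)
  refine ⟨_, hrel.tendsto_dist _ _ _ _ hx hp, fun n => ⟨dist_nonneg, ?_⟩⟩
  have h := sq_dist_metricProj_add_le (hγs n) (ys n) (q := xs n)
    ⟨1, by simp, hγs1 n⟩
  rw [dist_comm (xs n), dist_comm (xs n)]
  exact le_of_sq_le_sq ((le_add_of_nonneg_left (sq_nonneg _)).trans h) dist_nonneg

/-- Mosco convergence implies convergence of the resolvents. -/
theorem MoscoConvergesTo.convergesTo_resolventMap (hrel : IsAsymptoticRelation Xs X)
    {f : X → EReal} {fs : ∀ n, Xs n → EReal} (hf : IsProperConvexLsc f)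
    (hfs : ∀ n, IsProperConvexLsc (fs n)) (hM : MoscoConvergesTo fs f) {xs : ∀ n, Xs n} {x : X}
    (hx : ConvergesTo xs x) {lam : ℝ} (hlam : 0 < lam) :
    ConvergesTo (fun n => resolventMap (fs n) lam (xs n)) (resolventMap f lam x) := by
  set p := resolventMap f lam x
  set ys : ∀ n, Xs n := fun n => resolventMap (fs n) lam (xs n)
  have hpD : p ∈ effDomain f := hf.resolventMap_mem hlam x
  obtain ⟨ws, hw, hfw⟩ := hM.exists_recovery p
  refine hrel.converges_of_dist ws ys p hw ?_
  have hwD : ∀ᶠ n in atTop, ws n ∈ effDomain (fs n) := hfw.eventually_lt_const hpD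
  have hFw : Tendsto (fun n => (fs n (ws n)).toReal) atTop (𝓝 (f p).toReal) :=
    (EReal.tendsto_toReal (ne_of_lt hpD) (hf.ne_bot p)).comp hfw
  set E : ℕ → ℝ := fun n => (fs n (ws n)).toReal + dist (xs n) (ws n) ^ 2 / (2 * lam) with hE
  have hElim : Tendsto E atTop (𝓝 ((f p).toReal + dist x p ^ 2 / (2 * lam))) :=
    hFw.add (((hrel.tendsto_dist _ _ _ _ hx hw).pow 2).div_const _)
  have hyD : ∀ n, ys n ∈ effDomain (fs n) := fun n => (hfs n).resolventMap_mem hlam (xs n)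
  have hvar : ∀ᶠ n in atTop, (fs n (ys n)).toReal + dist (xs n) (ys n) ^ 2 / (2 * lam) +
      dist (ws n) (ys n) ^ 2 / (2 * lam) ≤ E n := by
    filter_upwards [hwD] with n hn
    rw [dist_comm (ws n)]
    exact (hfs n).variational_inequality hlam ((hfs n).isProxPoint_resolventMap hlam (xs n)) hn
  have hbdd : ∃ R, ∀ᶠ n in atTop, dist (ys n) (ws n) ≤ R := by
    by_contra! hcon
    obtain ⟨φ, hφ, hφd⟩ := extraction_forall_of_frequently
      (fun k : ℕ => hcon k)
    have hF₀ : map φ atTop ≤ atTop := hφ.tendsto_atTop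
    have hd : Tendsto (fun n => dist (ys n) (ws n)) (map φ atTop) atTop :=
      tendsto_map'_iff.2 (tendsto_atTop_mono (fun k => (hφd k).le) tendsto_natCast_atTop_atTop)
    choose γs hγs hγs0 hγs1 using fun n => HadamardSpace.exists_geodesic (ws n) (ys n)
    -- If the resolvents escaped to infinity, these points would stay within distance 1 of `ws n`,
    -- while convexity and the quadratic decay of `fs n (ys n)` drive their values to `-∞`. A weak
    -- limit would then have value `⊥`.
    set us : ∀ n, Xs n := fun n => γs n (1 / (1 + dist (ys n) (ws n)))
    have ht : ∀ n, 1 / (1 + dist (ys n) (ws n)) ∈ Icc (0 : ℝ) 1 := fun n =>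
      ⟨by positivity, by
        rw [div_le_one (by positivity)]
        exact le_add_of_nonneg_right dist_nonneg⟩
    have hu1 : ∀ n, dist (us n) (ws n) ≤ 1 := fun n => by
      have h := (hγs n).dist_zero (ht n)
      rw [hγs0, hγs1, dist_comm (ws n) (ys n)] at h
      rw [dist_comm, h, div_mul_eq_mul_div, div_le_one (by positivity)]
      linarith
    obtain ⟨G, hGF₀, hGn, c, us', hc, heq⟩ :=
      hrel.exists_weaklyConvergesTo hF₀ hw (Eventually.of_forall hu1)
    have hG : G ≤ atTop := hGF₀.trans hF₀
    set C := |(f p).toReal| + 1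
    set C' := |(f p).toReal + dist x p ^ 2 / (2 * lam)| + 1
    have hupper : ∀ M : ℝ, f c ≤ M := by
      intro M
      refine hM.le_of_tendsto hc hG heq tendsto_const_nhds ?_
      filter_upwards [hG hvar, hG hwD, hG (hFw.eventually_lt_const
        (lt_of_le_of_lt (le_abs_self _) (lt_add_one _))), hG (hElim.eventually_lt_const
        (lt_of_le_of_lt (le_abs_self _) (lt_add_one _))), (hd.mono_left hGF₀).eventually_ge_atTop
        (max 1 (4 * lam * (C + C' - M)))] with n h1 h2 h3 h4 h5
      obtain ⟨h6, h7⟩ := (hfs n).convex_toReal (hγs n) (by rwa [hγs0]) (by rw [hγs1]; exact hyD n)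
        (ht n)
      rw [← (hfs n).coe_toReal h6]
      refine EReal.coe_le_coe_iff.2 (h7.trans ?_)
      rw [hγs0, hγs1]
      have h8 := ht n
      have h9 : 1 / (1 + dist (ys n) (ws n)) * (1 + dist (ys n) (ws n)) = 1 := by
        field_simp
      rw [dist_comm (ws n)] at h1
      set d := dist (ys n) (ws n)
      set t := 1 / (1 + d)
      have h10 : (fs n (ys n)).toReal ≤ C' - d ^ 2 / (2 * lam) := by
        have : 0 ≤ dist (xs n) (ys n) ^ 2 / (2 * lam) := by positivity
        linarith
      have hd1 : 1 ≤ d := (le_max_left _ _).trans h5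
      -- For `d ≥ 1` one has `1 + d ≤ 2d`, whence the factor 4.
      have h11 : d / (4 * lam) ≤ t * (d ^ 2 / (2 * lam)) := by
        have : t * (d ^ 2 / (2 * lam)) = d ^ 2 / ((1 + d) * (2 * lam)) := by
          simp only [t]; field_simp
        rw [this, div_le_div_iff₀ (by positivity) (by positivity)]
        nlinarith [mul_pos hlam (by linarith : 0 < d), mul_nonneg (mul_pos hlam
          (by linarith : 0 < d)).le (sub_nonneg.2 hd1)]
      have h12 : C + C' - M ≤ d / (4 * lam) := by
        rw [le_div_iff₀ (by positivity)]
        linarith [(le_max_right _ _).trans h5]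
      have hC : 0 ≤ C := by positivity
      have hC' : 0 ≤ C' := by positivity
      have h13 : (1 - t) * (fs n (ws n)).toReal ≤ (1 - t) * C :=
        mul_le_mul_of_nonneg_left h3.le (by linarith [h8.2])
      have h14 := mul_le_mul_of_nonneg_left h10 h8.1
      nlinarith [mul_nonneg h8.1 hC, mul_nonneg (sub_nonneg.2 h8.2) hC']
    have := (hf.mem_effDomain_and_le (hupper ((f c).toReal - 1))).2
    linarith
  obtain ⟨R, hR⟩ := hbdd
  by_contra hcon
  rw [Metric.tendsto_nhds] at hcon
  push Not at hcon
  obtain ⟨ε, hε, hfreq⟩ := hcon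
  have hFn : (atTop ⊓ 𝓟 {n | ε ≤ dist (dist (ws n) (ys n)) 0}).NeBot :=
    frequently_iff_neBot.1 hfreq
  obtain ⟨G, hGF, hGn, c, ys', hc, heq⟩ := hrel.exists_weaklyConvergesTo
    (F₀ := atTop ⊓ 𝓟 {n | ε ≤ dist (dist (ws n) (ys n)) 0}) inf_le_left hw
    (hR.filter_mono inf_le_left)
  have hG : G ≤ atTop := hGF.trans inf_le_left
  obtain ⟨a, ha, hale⟩ := hc.exists_tendsto_le_dist hrel hx
  -- The surplus `d(ws, ys)² / (2λ)` survives as `ε² / (2λ)`, so the weak limit `c` would have a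
  -- strictly smaller proximal value than the minimizer `p`.
  have hfc : f c ≤ (((f p).toReal + dist x p ^ 2 / (2 * lam) - dist x c ^ 2 / (2 * lam) -
      ε ^ 2 / (2 * lam) : ℝ) : EReal) := by
    refine hM.le_of_tendsto hc hG heq (((hElim.sub ((ha.pow 2).div_const (2 * lam))).sub_const
      (ε ^ 2 / (2 * lam))).mono_left hG) ?_
    filter_upwards [hG hvar, heq, hGF (mem_inf_of_right (mem_principal_self _))] with n h1 h2 h3
    rw [← (hfs n).coe_toReal (hyD n)]
    refine EReal.coe_le_coe_iff.2 ?_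
    have h4 := (hale n).2
    rw [h2] at h4
    have h5 : a n ^ 2 / (2 * lam) ≤ dist (xs n) (ys n) ^ 2 / (2 * lam) := by
      have := pow_le_pow_left₀ (hale n).1 h4 2
      gcongr
    have h6 : ε ^ 2 / (2 * lam) ≤ dist (ws n) (ys n) ^ 2 / (2 * lam) := by
      rw [Real.dist_0_eq_abs, abs_of_nonneg dist_nonneg] at h3
      gcongr
    linarith
  obtain ⟨hcD, hcle⟩ := hf.mem_effDomain_and_le hfc
  have hmin := (hf.isProxPoint_iff.1 (hf.isProxPoint_resolventMap hlam x)).2 c hcD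
  have : 0 < ε ^ 2 / (2 * lam) := by positivity
  linarith

/-- Convergence of the resolvents implies convergence of the semigroups. -/
theorem convergesTo_semigroupMap (hrel : IsAsymptoticRelation Xs X)
    {f : X → EReal} {fs : ∀ n, Xs n → EReal} (hf : IsProperConvexLsc f)
    (hfs : ∀ n, IsProperConvexLsc (fs n))
    (hres : ∀ x ∈ closure (effDomain f), ∀ xs : ∀ n, Xs n, ConvergesTo xs x → ∀ lam : ℝ, 0 < lam →
      ConvergesTo (fun n => resolventMap (fs n) lam (xs n)) (resolventMap f lam x))
    {x : X} (hxD : x ∈ closure (effDomain f)) {xs : ∀ n, Xs n} (hx : ConvergesTo xs x) {t : ℝ}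
    (ht : 0 < t) :
    ConvergesTo (fun n => semigroupMap (fs n) t (xs n)) (semigroupMap f t x) := by
  have hiter : ∀ lam : ℝ, 0 < lam → ∀ k : ℕ, (resolventMap f lam)^[k] x ∈ closure (effDomain f) ∧
      ConvergesTo (fun n => (resolventMap (fs n) lam)^[k] (xs n)) ((resolventMap f lam)^[k] x) := by
    intro lam hlam k
    induction k with
    | zero => exact ⟨hxD, hx⟩
    | succ k ih =>
      simp only [Function.iterate_succ_apply']
      exact ⟨subset_closure (hf.resolventMap_mem hlam _), hres _ ih.1 _ ih.2 lam hlam⟩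
  obtain ⟨rs, hrs⟩ := hrel.exists_converging (semigroupMap f t x)
  refine hrel.converges_of_dist rs _ _ hrs (Metric.tendsto_nhds.2 fun ε hε => ?_)
  obtain ⟨nu, hnu, hxnu⟩ := hf.exists_dist_resolventMap_self_lt hxD (by positivity : 0 < ε / 8)
  have hlim1 : Tendsto (fun k : ℕ => t / k) atTop (𝓝 0) := tendsto_const_div_atTop_nhds_zero_nat t
  have hlim2 : Tendsto (fun k : ℕ => ε / 8 / nu * (t / √k)) atTop (𝓝 0) := by
    have : Tendsto (fun k : ℕ => t / √k) atTop (𝓝 0) :=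
      tendsto_const_nhds.div_atTop (Real.tendsto_sqrt_atTop.comp tendsto_natCast_atTop_atTop)
    simpa using this.const_mul (ε / 8 / nu)
  obtain ⟨k, hk1, hk2, hk3⟩ := ((hlim1.eventually_le_const hnu).and
    ((hlim2.eventually_le_const (by positivity : 0 < ε / 8)).and (eventually_gt_atTop 0))).exists
  have hkpos : (0 : ℝ) < k := Nat.cast_pos.2 hk3
  -- The same `k` serves the limit and all late `n`: each exponential formula errs by less than
  -- `3ε/8`, and the two errors sum to less than `ε`.
  have herr : ∀ d : ℝ, d < ε / 8 → 2 * d + d / nu * (t / √k) < 3 * ε / 8 := fun d hd => by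
    have : d / nu * (t / √k) ≤ ε / 8 / nu * (t / √k) := by gcongr
    linarith
  have hlimit := hf.dist_iterate_semigroupMap_le ht x hk3 hk1
  have hdist := hrel.tendsto_dist _ _ _ _ hx (hres x hxD xs hx nu hnu)
  have hdist' := hrel.tendsto_dist _ _ _ _ (hiter _ (div_pos ht hkpos) k).2 hrs
  filter_upwards [hdist.eventually_lt_const hxnu,
    hdist'.eventually_lt_const (hlimit.trans_lt (herr _ hxnu))] with n h1 h2
  have h3 := ((hfs n).dist_iterate_semigroupMap_le ht (xs n) hk3 hk1).trans_lt (herr _ h1)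
  rw [Real.dist_0_eq_abs, abs_of_nonneg dist_nonneg]
  have h4 := dist_triangle_left (rs n) (semigroupMap (fs n) t (xs n))
    ((resolventMap (fs n) (t / k))^[k] (xs n))
  linarith

end VaryingSpaces

end HadamardFlow

open HadamardFlow
theorem theorem4p5 {X : Type*} [MetricSpace X] [HadamardSpace X]
    {Xs : ℕ → Type*} [∀ n, MetricSpace (Xs n)] [∀ n, HadamardSpace (Xs n)]
    [TopologicalSpace (TotalSpace Xs X)] (hrel : IsAsymptoticRelation Xs X)
    (f : X → EReal) (fs : ∀ n, Xs n → EReal)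
    (hf : IsProperConvexLsc f) (hfs : ∀ n, IsProperConvexLsc (fs n)) :
    (ResolventAndSemigroupWellDefined f ∧ ∀ n, ResolventAndSemigroupWellDefined (fs n)) ∧
    ((∀ x ∈ closure (effDomain f), ∀ xs : ∀ n, Xs n, ConvergesTo xs x → ∀ lam : ℝ, 0 < lam →
        ConvergesTo (fun n => resolventMap (fs n) lam (xs n)) (resolventMap f lam x)) →
      ∀ x ∈ closure (effDomain f), ∀ xs : ∀ n, Xs n, ConvergesTo xs x → ∀ t : ℝ, 0 < t →
        ConvergesTo (fun n => semigroupMap (fs n) t (xs n)) (semigroupMap f t x)) ∧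
    (MoscoConvergesTo fs f →
      ∀ x ∈ closure (effDomain f), ∀ xs : ∀ n, Xs n, ConvergesTo xs x → ∀ t : ℝ, 0 < t →
        ConvergesTo (fun n => semigroupMap (fs n) t (xs n)) (semigroupMap f t x)) := by
  refine ⟨⟨hf.resolventAndSemigroupWellDefined, fun n => (hfs n).resolventAndSemigroupWellDefined⟩,
    fun hres x hxD xs hx t ht => convergesTo_semigroupMap hrel hf hfs hres hxD hx ht,
    fun hM x hxD xs hx t ht => convergesTo_semigroupMap hrel hf hfs
      (fun _ _ _ hxs _ hlam => hM.convergesTo_resolventMap hrel hf hfs hxs hlam) hxD hx ht⟩
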